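/- For a rooted ordered tree $T$ write $|T|$ for its number of vertices, $\sigma(T)$ for the number of independent vertex subsets of $T$ (including the empty set), $\sigma_2(T)$ for the number of those independent subsets that do not contain the root, and $W(T)$ for the Wiener index, i.e. the sum of the graph distances over all unordered pairs of vertices of $T$. Define the generating functions (sums over all finite rooted ordered trees) $$S_2(z)=\sum_T\sigma_2(T)\,z^{|T|},\qquad \mathrm{WS}(z)=\sum_T W(T)\,\sigma(T)\,z^{|T|}.$$ (1) Both series converge for $|z|<\frac4{27}$, and there is $R>\frac4{27}$ such that both functions extend analytically to the slit disc $\Delta_R=\{z\in\mathbb C: |z|<R\}\setminus[\frac4{27},\infty)$. There is a polynomial $N\in\mathbb Z[s,z]$ such that for all $z\in\Delta_R\setminus\{0\}$ the denominator below is nonzero and $$\mathrm{WS}(z)=\frac{N(S_2(z),z)}{(1-3S_2(z))^2\,(1-S_2(z))^3\,(S_2(z)^2+S_2(z)^3-z)^2}.$$ (2) As $z\to\frac4{27}$ within $\Delta_R$, $$\mathrm{WS}(z)\sim\frac{5}{81\left(1-\frac{27z}{4}\right)^2}.$$ (3) If $T_n$ is chosen uniformly at random among all rooted ordered trees on $n$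 vertices, and $W_n=W(T_n)$, $\sigma_n=\sigma(T_n)$, then as $n\to\infty$ $$E(W_n\sigma_n)\sim\frac{20\sqrt\pi}{81}\,n^{5/2}\left(\frac{27}{16}\right)^n.$$ -/

import Mathlib

open Filter Topology Asymptotics

/-- A (finite) rooted ordered tree: a root together with the ordered list of its branches. -/
inductive OrderedTree : Type where
  | node (branches : List OrderedTree) : OrderedTree

namespace OrderedTree

/-- The vertices of a rooted ordered tree: the root, and the vertices of each of the branches. -/
inductive Vertex : OrderedTree → Type where
  | root (l : List OrderedTree) : Vertex (node l)
  | inBranch (l : List OrderedTree) (i : Fin l.length) (v : Vertex (l.get i)) : Vertex (node l)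

/-- The root of a rooted ordered tree. -/
def rootVertex : (t : OrderedTree) → Vertex t
  | node l => Vertex.root l

/-- `IsParent u v`: the vertex `u` is the parent of the vertex `v`. -/
inductive IsParent : (t : OrderedTree) → Vertex t → Vertex t → Prop where
  | root (l : List OrderedTree) (i : Fin l.length) :
      IsParent (node l) (Vertex.root l) (Vertex.inBranch l i (rootVertex (l.get i)))
  | inBranch (l : List OrderedTree) (i : Fin l.length) (u v : Vertex (l.get i))
      (h : IsParent (l.get i) u v) :
      IsParent (node l) (Vertex.inBranch l i u) (Vertex.inBranch l i v)

/-- The underlying graph of a rooted ordered tree: each vertex is joined to its children. -/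
def graph (t : OrderedTree) : SimpleGraph (Vertex t) :=
  SimpleGraph.fromRel (IsParent t)

/-- The vertex set of a tree, decomposed into the root and the vertex sets of the branches. -/
def vertexEquiv (l : List OrderedTree) :
    Vertex (node l) ≃ Option (Σ i : Fin l.length, Vertex (l.get i)) where
  toFun v := match v with
    | Vertex.root _ => none
    | Vertex.inBranch _ i w => some ⟨i, w⟩
  invFun o := match o with
    | none => Vertex.root l
    | some ⟨i, w⟩ => Vertex.inBranch l i w
  left_inv v := by cases v <;> rfl
  right_inv o := by rcases o with _ | ⟨i, w⟩ <;> rfl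

theorem finite_vertex : ∀ t : OrderedTree, Finite (Vertex t)
  | node l =>
    have : ∀ i : Fin l.length, Finite (Vertex (l.get i)) := fun i => finite_vertex (l.get i)
    Finite.of_equiv _ (vertexEquiv l).symm
termination_by t => sizeOf t
decreasing_by
  have h := List.sizeOf_lt_of_mem (List.get_mem l i)
  simp only [node.sizeOf_spec]
  omega

noncomputable instance (t : OrderedTree) : Fintype (Vertex t) :=
  have := finite_vertex t
  Fintype.ofFinite _

/-- The number of vertices of a tree. -/
noncomputable def size (t : OrderedTree) : ℕ := Fintype.card (Vertex t)

theorem size_node (l : List OrderedTree) :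
    size (node l) = (∑ i : Fin l.length, size (l.get i)) + 1 := by
  unfold size
  rw [Fintype.card_congr (vertexEquiv l), Fintype.card_option, Fintype.card_sigma]

theorem size_pos (t : OrderedTree) : 0 < size t := by
  cases t with
  | node l => rw [size_node]; omega

theorem finite_size_le (n : ℕ) : {t : OrderedTree | size t ≤ n}.Finite := by
  induction n with
  | zero =>
    refine Set.Finite.subset Set.finite_empty fun t ht => ?_
    have := size_pos t
    simp only [Set.mem_ofPred_eq] at ht
    omega
  | succ n ih =>
    have : Finite {t : OrderedTree | size t ≤ n} := ih
    refine Set.Finite.subset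
      ((List.finite_length_le {t : OrderedTree | size t ≤ n} n).image
        fun l => node (l.map Subtype.val)) ?_
    rintro ⟨l⟩ hl
    simp only [Set.mem_ofPred_eq, size_node] at hl
    have hmem : ∀ t ∈ l, size t ≤ n := by
      intro t ht
      obtain ⟨i, rfl⟩ := List.get_of_mem ht
      have := Finset.single_le_sum (f := fun i : Fin l.length => size (l.get i))
        (fun _ _ => Nat.zero_le _) (Finset.mem_univ i)
      omega
    have hlen : l.length ≤ n := by
      have : ∑ _i : Fin l.length, 1 ≤ ∑ i : Fin l.length, size (l.get i) :=
        Finset.sum_le_sum fun i _ => size_pos _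
      simp only [Finset.sum_const, Finset.card_univ, Fintype.card_fin, smul_eq_mul,
        mul_one] at this
      omega
    refine ⟨l.pmap Subtype.mk hmem, by simpa using hlen, ?_⟩
    simp only [List.map_pmap]
    exact congrArg node (List.pmap_eq_self.2 fun _ _ => rfl)

/-- The finite set of all rooted ordered trees on `n` vertices. -/
noncomputable def treesOfSize (n : ℕ) : Finset OrderedTree :=
  ((finite_size_le n).subset
    (fun _ h => le_of_eq h : {t : OrderedTree | size t = n} ⊆ _)).toFinset

theorem mem_treesOfSize {n : ℕ} {t : OrderedTree} : t ∈ treesOfSize n ↔ size t = n := by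
  simp [treesOfSize]

/-- The `σ`-index: the number of independent vertex subsets (including the empty set). -/
noncomputable def sigma (t : OrderedTree) : ℕ :=
  {s : Set (Vertex t) | (graph t).IsIndepSet s}.ncard

/-- The number of independent vertex subsets that do not contain the root. -/
noncomputable def sigmaTwo (t : OrderedTree) : ℕ :=
  {s : Set (Vertex t) | (graph t).IsIndepSet s ∧ rootVertex t ∉ s}.ncard

open Classical in
/-- The Wiener index: the sum of the distances over all unordered pairs of vertices
(the diagonal pairs contribute `0`). -/
noncomputable def wiener (t : OrderedTree) : ℕ :=
  ∑ e : Sym2 (Vertex t),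
    Sym2.lift ⟨fun v w => (graph t).dist v w, fun _ _ => SimpleGraph.dist_comm⟩ e

/-- The expected value of `f T`, for `T` uniformly distributed on the rooted ordered trees
on `n` vertices. -/
noncomputable def expectation (f : OrderedTree → ℝ) (n : ℕ) : ℝ :=
  (∑ t ∈ treesOfSize n, f t) / ((treesOfSize n).card : ℝ)

end OrderedTree

/-- The open disc of radius `R` about `0`, slit along the real half-line from `4/27` on. -/
def slitDisc (R : ℝ) : Set ℂ :=
  {z : ℂ | ‖z‖ < R ∧ ¬ (z.im = 0 ∧ 4 / 27 ≤ z.re)}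

/-- The denominator `(1 - 3 s)² (1 - s)³ (s² + s³ - z)²`. -/
def wsDenominator (s z : ℂ) : ℂ :=
  (1 - 3 * s) ^ 2 * (1 - s) ^ 3 * (s ^ 2 + s ^ 3 - z) ^ 2

/-!
A rooted ordered tree with more than one vertex is obtained in exactly one way by attaching a tree
`t` as a new first branch to the root of a tree `r`; this is `graft t r`. Its graph consists of
the graphs of `t` and `r` and an edge between the two roots (`graftIso`). Hence `sigmaTwo` and the
number `sigmaOne` of independent sets with the root are multiplicative,
`σ₂(graft t r) = σ(t) σ₂(r)` and `σ₁(graft t r) = σ₂(t) σ₁(r)`, and the size, the sum `rootDist`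
of the distances from the root, and the Wiener index satisfy additive recurrences
(`wiener_graft`). For the generating functions the recurrences become algebraic equations. They
give `s (1 - s)² = z` for `s = S₂(z)` (`gf_sigmaTwo_cubic`), and three linear systems in
succession, for the series of `size * σᵢ`, `rootDist * σᵢ` and `wiener * σᵢ`. Therefore `WS(z)` is
an explicit rational function `wienerRat` of `s` (`gf_wiener_sigma`). Its denominator is
`(1 - 3 s)⁴ (1 - s)³`, which is the required one up to the factor `s²`, as
`s² + s³ - z = -s (1 - 3 s)`. Convergence for `‖z‖ < 4 / 27` holds because the series of `σ`
converges even at `4 / 27` (`sum_sigma_le`), and the weights are at most cubic in the size.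

The equation `s (1 - s)² = z` is solved by `s = (2 - 2 cosh (2 x / 3)) / 3` with
`cosh x = √(1 - 27 z / 4)`. This `branch` is holomorphic in the whole plane slit along
`[4 / 27, ∞)`: the sign of `sinh x` does not matter, so the only questionable point is `z = 0`,
where `branch` is continuous. It agrees with the series because both take values in the disc of
radius `1 / 3`, on which `s ↦ s (1 - s)²` is injective. As the branch takes the value `1 / 3` only
at `z = 4 / 27`, and the value `1` nowhere, `wienerRat` of it is holomorphic in the slit plane.
The identity `1 - 27 z / 4 = (1 - 3 s)² (4 - 3 s) / 4` gives the behaviour at `4 / 27`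
(`wienerFun_isEquivalent`).

For the coefficients, subtract `(5 / 81) / (1 - 27 z / 4)²` from `WS(z)`. In the disc, the
difference is bounded by `ε ‖1 - 27 z / 4‖⁻² + C` for each `ε > 0`. The mean of `‖1 - w‖⁻²` over
the circle of radius `r < 1` is `1 / (1 - r²)`, so Cauchy's formula on the circle with
`r = 1 - 1 / (n + 1)` shows that the coefficients of the difference are of smaller order than
`n (27 / 4) ^ n` (`UnitDisc.coeff_isLittleO`). The number of trees on `n` vertices is the Catalan
number with index `n - 1`, whose asymptotics follow from Stirling's formula.
-/

/-! ### Joining two rooted graphs by an edge between their roots -/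

namespace SimpleGraph

variable {V W : Type*}

/-- The disjoint union of the graphs `G` and `H` together with one further edge, which joins the
vertex `a` of `G` to the vertex `b` of `H`. -/
def joinAt (G : SimpleGraph V) (a : V) (H : SimpleGraph W) (b : W) : SimpleGraph (V ⊕ W) where
  Adj
    | .inl v, .inl v' => G.Adj v v'
    | .inr w, .inr w' => H.Adj w w'
    | .inl v, .inr w => v = a ∧ w = b
    | .inr w, .inl v => v = a ∧ w = b
  symm := ⟨by
    rintro (v | w) (v' | w') h
    · exact G.adj_symm h
    · exact h
    · exact h
    · exact H.adj_symm h⟩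
  loopless := ⟨by
    rintro (v | w) h
    · exact G.irrefl h
    · exact H.irrefl h⟩

variable {G : SimpleGraph V} {a : V} {H : SimpleGraph W} {b : W}

@[simp] theorem joinAt_adj_inl_inl {v v' : V} :
    (joinAt G a H b).Adj (.inl v) (.inl v') ↔ G.Adj v v' := Iff.rfl

@[simp] theorem joinAt_adj_inr_inr {w w' : W} :
    (joinAt G a H b).Adj (.inr w) (.inr w') ↔ H.Adj w w' := Iff.rfl

@[simp] theorem joinAt_adj_inl_inr {v : V} {w : W} :
    (joinAt G a H b).Adj (.inl v) (.inr w) ↔ v = a ∧ w = b := Iff.rfl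

@[simp] theorem joinAt_adj_inr_inl {v : V} {w : W} :
    (joinAt G a H b).Adj (.inr w) (.inl v) ↔ v = a ∧ w = b := Iff.rfl

/-- `G` maps into the joined graph. -/
def joinAtInl (G : SimpleGraph V) (a : V) (H : SimpleGraph W) (b : W) : G →g joinAt G a H b where
  toFun := Sum.inl
  map_rel' h := h

/-- `H` maps into the joined graph. -/
def joinAtInr (G : SimpleGraph V) (a : V) (H : SimpleGraph W) (b : W) : H →g joinAt G a H b where
  toFun := Sum.inr
  map_rel' h := h

theorem Connected.joinAt (hG : G.Connected) (hH : H.Connected) : (joinAt G a H b).Connected := by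
  have hl : ∀ v, (SimpleGraph.joinAt G a H b).Reachable (.inl a) (.inl v) := fun v =>
    (hG.preconnected a v).map (joinAtInl G a H b)
  have hab : (SimpleGraph.joinAt G a H b).Reachable (.inl a) (.inr b) :=
    Adj.reachable (by simp)
  have hr : ∀ w, (SimpleGraph.joinAt G a H b).Reachable (.inl a) (.inr w) := fun w =>
    hab.trans ((hH.preconnected b w).map (joinAtInr G a H b))
  have h : ∀ p, (SimpleGraph.joinAt G a H b).Reachable (.inl a) p := by
    rintro (v | w)
    exacts [hl v, hr w]
  have := hG.nonempty
  exact ⟨fun p q => (h p).symm.trans (h q)⟩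

/-- A function that vanishes at `u` and grows by at most one along each edge is a lower bound for
the distance from `u`. -/
theorem le_dist_of_forall_adj {U : Type*} {K : SimpleGraph U} (hK : K.Connected) {u : U} (φ : U → ℕ)
    (h0 : φ u = 0) (hφ : ∀ x y, K.Adj x y → φ y ≤ φ x + 1) (v : U) : φ v ≤ K.dist u v := by
  obtain ⟨p, hp⟩ := hK.exists_walk_length_eq_dist u v
  have key : ∀ {x y : U} (p : K.Walk x y), φ y ≤ φ x + p.length := by
    intro x y p
    induction p with
    | nil => simp
    | cons h p ih =>
      have := hφ _ _ h
      simp only [Walk.length_cons]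
      omega
  have := key p
  omega

theorem Hom.dist_map_le {U U' : Type*} {K : SimpleGraph U} {K' : SimpleGraph U'} (f : K →g K')
    (hK : K.Connected) (u v : U) : K'.dist (f u) (f v) ≤ K.dist u v := by
  obtain ⟨p, hp⟩ := hK.exists_walk_length_eq_dist u v
  rw [← hp, ← Walk.length_map f p]
  exact dist_le _

theorem Iso.dist_map {U U' : Type*} {K : SimpleGraph U} {K' : SimpleGraph U'} (f : K ≃g K')
    (hK : K.Connected) (u v : U) : K'.dist (f u) (f v) = K.dist u v := by
  refine le_antisymm (Hom.dist_map_le f.toHom hK u v) ?_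
  simpa using Hom.dist_map_le f.symm.toHom (f.connected_iff.1 hK) (f u) (f v)

theorem Connected.dist_le_dist_add_one {U : Type*} {K : SimpleGraph U} (hK : K.Connected)
    (u : U) {x y : U} (h : K.Adj x y) : K.dist u y ≤ K.dist u x + 1 := by
  have h1 := hK.dist_triangle (u := u) (v := x) (w := y)
  have h2 := dist_eq_one_iff_adj.2 h
  omega

theorem dist_joinAt_inl_inl (hG : G.Connected) (hH : H.Connected) (v v' : V) :
    (joinAt G a H b).dist (.inl v) (.inl v') = G.dist v v' := by
  refine le_antisymm (Hom.dist_map_le (joinAtInl G a H b) hG v v') ?_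
  refine le_dist_of_forall_adj (hG.joinAt hH)
    (Sum.elim (fun x => G.dist v x) fun _ => G.dist v a) (by simp) ?_ (.inl v')
  rintro (x | x) (y | y) h
  · exact hG.dist_le_dist_add_one v h
  · simp [(joinAt_adj_inl_inr.1 h).1]
  · simp [(joinAt_adj_inr_inl.1 h).1]
  · simp

theorem dist_joinAt_inr_inr (hG : G.Connected) (hH : H.Connected) (w w' : W) :
    (joinAt G a H b).dist (.inr w) (.inr w') = H.dist w w' := by
  refine le_antisymm (Hom.dist_map_le (joinAtInr G a H b) hH w w') ?_
  refine le_dist_of_forall_adj (hG.joinAt hH)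
    (Sum.elim (fun _ => H.dist w b) fun x => H.dist w x) (by simp) ?_ (.inr w')
  rintro (x | x) (y | y) h
  · simp
  · simp [(joinAt_adj_inl_inr.1 h).2]
  · simp [(joinAt_adj_inr_inl.1 h).2]
  · exact hH.dist_le_dist_add_one w h

theorem dist_joinAt_inl_inr (hG : G.Connected) (hH : H.Connected) (v : V) (w : W) :
    (joinAt G a H b).dist (.inl v) (.inr w) = G.dist a v + 1 + H.dist b w := by
  have hJ : (joinAt G a H b).Connected := hG.joinAt hH
  refine le_antisymm ?_ ?_
  · have h1 := hJ.dist_triangle (u := .inl v) (v := .inl a) (w := .inr w)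
    have h2 := hJ.dist_triangle (u := .inl a) (v := .inr b) (w := .inr w)
    have h3 : (joinAt G a H b).dist (.inl a) (.inr b) = 1 := dist_eq_one_iff_adj.2 (by simp)
    rw [dist_joinAt_inl_inl hG hH, dist_comm (u := v)] at h1
    rw [dist_joinAt_inr_inr hG hH] at h2
    omega
  · rw [dist_comm (u := a)]
    refine le_dist_of_forall_adj hJ
      (Sum.elim (fun x => G.dist v x) fun x => G.dist v a + 1 + H.dist b x) (by simp) ?_ (.inr w)
    rintro (x | x) (y | y) h
    · exact hG.dist_le_dist_add_one v h
    · simp [(joinAt_adj_inl_inr.1 h).1, (joinAt_adj_inl_inr.1 h).2]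
    · simp only [(joinAt_adj_inr_inl.1 h).1, Sum.elim_inl, Sum.elim_inr]
      omega
    · have := hH.dist_le_dist_add_one b h
      simp only [Sum.elim_inr]
      omega

theorem dist_joinAt_inr_inl (hG : G.Connected) (hH : H.Connected) (w : W) (v : V) :
    (joinAt G a H b).dist (.inr w) (.inl v) = G.dist a v + 1 + H.dist b w := by
  rw [dist_comm, dist_joinAt_inl_inr hG hH]

theorem isIndepSet_joinAt_iff {s : Set (V ⊕ W)} :
    (joinAt G a H b).IsIndepSet s ↔ G.IsIndepSet (Sum.inl ⁻¹' s) ∧ H.IsIndepSet (Sum.inr ⁻¹' s) ∧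
      ¬ (.inl a ∈ s ∧ .inr b ∈ s) := by
  simp only [isIndepSet_iff, Set.Pairwise, Set.mem_preimage]
  constructor
  · intro h
    exact ⟨fun x hx y hy hxy => h hx hy (by simpa using hxy),
      fun x hx y hy hxy => h hx hy (by simpa using hxy),
      fun hab => h hab.1 hab.2 (by simp) (by simp)⟩
  · rintro ⟨hG, hH, hab⟩ (x | x) hx (y | y) hy hxy
    · exact hG hx hy (by simpa using hxy)
    · rintro ⟨rfl, rfl⟩
      exact hab ⟨hx, hy⟩
    · rintro ⟨rfl, rfl⟩
      exact hab ⟨hy, hx⟩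
    · exact hH hx hy (by simpa using hxy)

theorem Iso.isIndepSet_preimage_iff {U U' : Type*} {K : SimpleGraph U} {K' : SimpleGraph U'}
    (f : K ≃g K') {s : Set U'} : K.IsIndepSet (f ⁻¹' s) ↔ K'.IsIndepSet s := by
  simp only [isIndepSet_iff, Set.Pairwise, Set.mem_preimage]
  rw [f.surjective.forall]
  refine forall_congr' fun x => imp_congr_right fun _ => ?_
  rw [f.surjective.forall]
  simp [f.map_adj_iff]

end SimpleGraph

/-! ### Grafting, and the recurrences for the tree parameters -/

namespace OrderedTree

/-- The tree obtained from `r` by attaching `t` as a new first branch. -/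
def graft (t : OrderedTree) : OrderedTree → OrderedTree
  | node l => node (t :: l)

/-- The tree with a single vertex. -/
def leaf : OrderedTree := node []

/-- Every tree is either a single vertex or, in a unique way, of the form `graft t r`. -/
def graftEquiv : Option (OrderedTree × OrderedTree) ≃ OrderedTree where
  toFun
    | none => leaf
    | some p => graft p.1 p.2
  invFun
    | node [] => none
    | node (t :: l) => some (t, node l)
  left_inv := by
    rintro (_ | ⟨t, ⟨l⟩⟩) <;> rfl
  right_inv := by
    rintro ⟨_ | ⟨t, l⟩⟩ <;> rfl

@[simp] theorem graftEquiv_none : graftEquiv none = leaf := rfl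

@[simp] theorem graftEquiv_some (p : OrderedTree × OrderedTree) :
    graftEquiv (some p) = graft p.1 p.2 := rfl

theorem graft_induction {P : OrderedTree → Prop} (hl : P leaf)
    (hg : ∀ t r, P t → P r → P (graft t r)) : ∀ t, P t
  | node [] => hl
  | node (t :: l) => hg t (node l) (graft_induction hl hg t) (graft_induction hl hg (node l))

/-- The vertices of `t` as vertices of `graft t r`. -/
def graftInl (t : OrderedTree) : (r : OrderedTree) → Vertex t → Vertex (graft t r)
  | node l, v => Vertex.inBranch (t :: l) ⟨0, Nat.succ_pos _⟩ v

/-- The vertices of `r` as vertices of `graft t r`. -/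
def graftInr (t : OrderedTree) : (r : OrderedTree) → Vertex r → Vertex (graft t r)
  | node l, Vertex.root _ => Vertex.root (t :: l)
  | node l, Vertex.inBranch _ i v => Vertex.inBranch (t :: l) i.succ v

/-- The vertices of `graft t r` are those of `t` and those of `r`. -/
def graftVertexEquiv (t : OrderedTree) :
    (r : OrderedTree) → Vertex t ⊕ Vertex r ≃ Vertex (graft t r)
  | node l =>
    { toFun := Sum.elim (graftInl t (node l)) (graftInr t (node l))
      invFun := fun v => match v with
        | Vertex.root _ => .inr (Vertex.root l)
        | Vertex.inBranch _ ⟨0, _⟩ v => .inl v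
        | Vertex.inBranch _ ⟨i + 1, h⟩ v => .inr (Vertex.inBranch l ⟨i, Nat.lt_of_succ_lt_succ h⟩ v)
      left_inv := by
        rintro (v | v)
        · rfl
        · cases v <;> rfl
      right_inv := by
        intro v
        match v with
        | Vertex.root _ => rfl
        | Vertex.inBranch _ ⟨0, _⟩ v => rfl
        | Vertex.inBranch _ ⟨i + 1, h⟩ v => rfl }

theorem graftVertexEquiv_inl (t r : OrderedTree) (v : Vertex t) :
    graftVertexEquiv t r (.inl v) = graftInl t r v := by
  cases r; rfl

theorem graftVertexEquiv_inr (t r : OrderedTree) (v : Vertex r) :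
    graftVertexEquiv t r (.inr v) = graftInr t r v := by
  cases r; rfl

theorem graftInr_root (t r : OrderedTree) :
    graftInr t r (rootVertex r) = rootVertex (graft t r) := by
  cases r; rfl

theorem isParent_node_iff {l : List OrderedTree} {u v : Vertex (node l)} :
    IsParent (node l) u v ↔
      (∃ i, u = Vertex.root l ∧ v = Vertex.inBranch l i (rootVertex (l.get i))) ∨
      ∃ i u' v', IsParent (l.get i) u' v' ∧ u = Vertex.inBranch l i u' ∧
        v = Vertex.inBranch l i v' := by
  constructor
  · intro h
    cases h with
    | root _ i => exact .inl ⟨i, rfl, rfl⟩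
    | inBranch _ i u v h => exact .inr ⟨i, u, v, h, rfl, rfl⟩
  · rintro (⟨i, rfl, rfl⟩ | ⟨i, u, v, h, rfl, rfl⟩)
    · exact .root l i
    · exact .inBranch l i u v h

theorem isParent_inBranch_iff {l : List OrderedTree} {i : Fin l.length} {u v : Vertex (l.get i)} :
    IsParent (node l) (Vertex.inBranch l i u) (Vertex.inBranch l i v) ↔
      IsParent (l.get i) u v := by
  refine ⟨fun h => ?_, .inBranch l i u v⟩
  rcases isParent_node_iff.1 h with ⟨j, hu, -⟩ | ⟨j, u', v', h', hu, hv⟩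
  · cases hu
  · cases hu
    cases hv
    exact h'

theorem not_isParent_root {l : List OrderedTree} {u : Vertex (node l)} :
    ¬ IsParent (node l) u (Vertex.root l) := by
  intro h
  rcases isParent_node_iff.1 h with ⟨j, -, hv⟩ | ⟨j, u', v', -, -, hv⟩ <;> cases hv

theorem isParent_root_inBranch_iff {l : List OrderedTree} {i : Fin l.length}
    {v : Vertex (l.get i)} :
    IsParent (node l) (Vertex.root l) (Vertex.inBranch l i v) ↔ v = rootVertex (l.get i) := by
  refine ⟨fun h => ?_, fun h => h ▸ .root l i⟩
  rcases isParent_node_iff.1 h with ⟨j, -, hv⟩ | ⟨j, u', v', -, hu, -⟩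
  · cases hv
    rfl
  · cases hu

theorem eq_of_isParent_inBranch {l : List OrderedTree} {i j : Fin l.length}
    {u : Vertex (l.get i)} {v : Vertex (l.get j)}
    (h : IsParent (node l) (Vertex.inBranch l i u) (Vertex.inBranch l j v)) : i = j := by
  rcases isParent_node_iff.1 h with ⟨j, hu, -⟩ | ⟨k, u', v', -, hu, hv⟩
  · cases hu
  · cases hu
    cases hv
    rfl

theorem isParent_graftInl_iff {t r : OrderedTree} {u v : Vertex t} :
    IsParent (graft t r) (graftInl t r u) (graftInl t r v) ↔ IsParent t u v := by
  cases r with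
  | node l => exact isParent_inBranch_iff (l := t :: l) (i := ⟨0, Nat.succ_pos _⟩)

theorem isParent_graftInr_iff {t r : OrderedTree} {u v : Vertex r} :
    IsParent (graft t r) (graftInr t r u) (graftInr t r v) ↔ IsParent r u v := by
  cases r with
  | node l =>
    cases v with
    | root => exact iff_of_false not_isParent_root not_isParent_root
    | inBranch _ j v =>
      cases u with
      | root =>
        exact (isParent_root_inBranch_iff (l := t :: l) (i := j.succ)).trans
          isParent_root_inBranch_iff.symm
      | inBranch _ i u =>
        by_cases hij : i = j
        · subst hij
          exact (isParent_inBranch_iff (l := t :: l) (i := i.succ)).trans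
            (isParent_inBranch_iff (l := l) (i := i)).symm
        · exact iff_of_false
            (fun h => hij (Fin.succ_injective _ (eq_of_isParent_inBranch (l := t :: l) h)))
            fun h => hij (eq_of_isParent_inBranch h)

theorem not_isParent_graftInl_graftInr {t r : OrderedTree} {u : Vertex t} {v : Vertex r} :
    ¬ IsParent (graft t r) (graftInl t r u) (graftInr t r v) := by
  cases r with
  | node l =>
    cases v with
    | root => exact not_isParent_root
    | inBranch _ j v =>
      intro h
      exact (Fin.succ_ne_zero j) (eq_of_isParent_inBranch (l := t :: l) h).symm

theorem isParent_graftInr_graftInl_iff {t r : OrderedTree} {u : Vertex r} {v : Vertex t} :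
    IsParent (graft t r) (graftInr t r u) (graftInl t r v) ↔
      v = rootVertex t ∧ u = rootVertex r := by
  cases r with
  | node l =>
    cases u with
    | root =>
      exact (isParent_root_inBranch_iff (l := t :: l) (i := ⟨0, Nat.succ_pos _⟩)).trans
        (and_iff_left rfl).symm
    | inBranch _ j u =>
      refine iff_of_false (fun h => ?_) (fun h => ?_)
      · exact (Fin.succ_ne_zero j) (eq_of_isParent_inBranch (l := t :: l) h)
      · cases h.2

/-- The graph of `graft t r` arises from those of `t` and `r` by joining their roots. -/
def graftIso (t r : OrderedTree) :
    SimpleGraph.joinAt (graph t) (rootVertex t) (graph r) (rootVertex r) ≃g graph (graft t r) where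
  toEquiv := graftVertexEquiv t r
  map_rel_iff' := by
    rintro (u | u) (v | v) <;>
    simp only [graph, SimpleGraph.fromRel_adj, ne_eq, (graftVertexEquiv t r).injective.eq_iff] <;>
    simp [graftVertexEquiv_inl, graftVertexEquiv_inr, isParent_graftInl_iff,
      isParent_graftInr_iff, not_isParent_graftInl_graftInr, isParent_graftInr_graftInl_iff,
      SimpleGraph.fromRel_adj]

theorem graftIso_inr (t r : OrderedTree) (v : Vertex r) :
    graftIso t r (.inr v) = graftInr t r v := graftVertexEquiv_inr t r v

theorem graftIso_inr_root (t r : OrderedTree) :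
    graftIso t r (.inr (rootVertex r)) = rootVertex (graft t r) := by
  rw [graftIso_inr, graftInr_root]

instance : Unique (Vertex leaf) where
  default := rootVertex leaf
  uniq v := by
    cases v with
    | root => rfl
    | inBranch _ i v => exact i.elim0

theorem connected_graph (t : OrderedTree) : (graph t).Connected := by
  induction t using graft_induction with
  | hl => exact ⟨fun u v => by rw [Subsingleton.elim u v]⟩
  | hg t r ht hr => exact (graftIso t r).connected_iff.1 (ht.joinAt hr)

theorem size_leaf : size leaf = 1 := Fintype.card_unique

theorem size_graft (t r : OrderedTree) : size (graft t r) = size t + size r := by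
  unfold size
  rw [← Fintype.card_congr (graftIso t r).toEquiv, Fintype.card_sum]

/-- The sum of the distances of all vertices from the root. -/
noncomputable def rootDist (t : OrderedTree) : ℕ :=
  ∑ v : Vertex t, (graph t).dist (rootVertex t) v

theorem rootDist_leaf : rootDist leaf = 0 := by
  simp [rootDist, show (default : Vertex leaf) = rootVertex leaf from rfl]

theorem rootDist_graft (t r : OrderedTree) :
    rootDist (graft t r) = rootDist t + rootDist r + size t := by
  unfold rootDist
  rw [← (graftIso t r).toEquiv.sum_comp, Fintype.sum_sum_type, ← graftIso_inr_root]
  simp only [RelIso.coe_fn_toEquiv,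
    (graftIso t r).dist_map ((connected_graph t).joinAt (connected_graph r)),
    SimpleGraph.dist_joinAt_inr_inl (connected_graph t) (connected_graph r),
    SimpleGraph.dist_joinAt_inr_inr (connected_graph t) (connected_graph r)]
  simp [Finset.sum_add_distrib, size]
  ring

/-- Summing a symmetric function over all ordered pairs counts each unordered pair off the
diagonal twice. -/
theorem _root_.Sym2.two_mul_sum_lift {α : Type*} [Fintype α] [DecidableEq α] (f : α → α → ℕ)
    (hf : ∀ a b, f a b = f b a) (h0 : ∀ a, f a a = 0) :
    2 * ∑ e : Sym2 α, Sym2.lift ⟨f, hf⟩ e = ∑ a, ∑ b, f a b := by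
  rw [← Fintype.sum_prod_type', ← Finset.sum_fiberwise (Finset.univ : Finset (α × α))
    (fun p => s(p.1, p.2)), Finset.mul_sum]
  refine Finset.sum_congr rfl fun e _ => ?_
  induction e using Sym2.ind with
  | _ a b =>
    rw [Sym2.lift_mk]
    have hfil : (Finset.univ.filter fun p : α × α => s(p.1, p.2) = s(a, b)) = {(a, b), (b, a)} := by
      ext ⟨x, y⟩
      simp
    rw [hfil]
    by_cases hab : a = b
    · simp [hab, h0]
    · rw [Finset.sum_pair (by simp [hab])]
      simp only [hf b a]
      ring

theorem two_mul_wiener (t : OrderedTree) :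
    2 * wiener t = ∑ u : Vertex t, ∑ v : Vertex t, (graph t).dist u v := by
  classical
  rw [← Sym2.two_mul_sum_lift _ (fun _ _ => SimpleGraph.dist_comm) (fun _ => SimpleGraph.dist_self)]
  unfold wiener
  convert rfl

theorem wiener_leaf : wiener leaf = 0 := by
  have h := two_mul_wiener leaf
  simp at h
  exact h

theorem wiener_graft (t r : OrderedTree) :
    wiener (graft t r) = wiener t + wiener r + rootDist t * size r + size t * rootDist r
      + size t * size r := by
  have h : 2 * wiener (graft t r) = 2 * wiener t + 2 * wiener r +
      2 * (rootDist t * size r + size t * rootDist r + size t * size r) := by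
    simp only [two_mul_wiener]
    rw [← (graftIso t r).toEquiv.sum_comp]
    simp only [← (graftIso t r).toEquiv.sum_comp (fun v => (graph (graft t r)).dist _ v)]
    simp only [Fintype.sum_sum_type, RelIso.coe_fn_toEquiv,
      (graftIso t r).dist_map ((connected_graph t).joinAt (connected_graph r)),
      SimpleGraph.dist_joinAt_inr_inl (connected_graph t) (connected_graph r),
      SimpleGraph.dist_joinAt_inl_inr (connected_graph t) (connected_graph r),
      SimpleGraph.dist_joinAt_inl_inl (connected_graph t) (connected_graph r),
      SimpleGraph.dist_joinAt_inr_inr (connected_graph t) (connected_graph r)]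
    simp only [Finset.sum_add_distrib, Finset.sum_const, Finset.card_univ, smul_eq_mul,
      ← Finset.mul_sum, mul_one]
    rw [show Fintype.card (Vertex t) = size t from rfl,
      show Fintype.card (Vertex r) = size r from rfl,
      show ∑ x, (graph t).dist (rootVertex t) x = rootDist t from rfl,
      show ∑ x, (graph r).dist (rootVertex r) x = rootDist r from rfl]
    ring
  omega

/-- The number of independent vertex subsets that contain the root. -/
noncomputable def sigmaOne (t : OrderedTree) : ℕ :=
  {s : Set (Vertex t) | (graph t).IsIndepSet s ∧ rootVertex t ∈ s}.ncard

theorem sigma_eq_add (t : OrderedTree) : sigma t = sigmaOne t + sigmaTwo t := by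
  unfold sigma sigmaOne sigmaTwo
  rw [← Set.ncard_union_eq]
  · congr 1
    ext s
    simp only [Set.mem_union, Set.mem_ofPred_eq]
    tauto
  · exact Set.disjoint_left.2 fun s hs hs' => hs'.2 hs.2

/-- A vertex subset of `graft t r` consists of a vertex subset of `t` and one of `r`. -/
def graftSetEquiv (t r : OrderedTree) :
    Set (Vertex (graft t r)) ≃ Set (Vertex t) × Set (Vertex r) where
  toFun s := (Sum.inl ⁻¹' (graftIso t r ⁻¹' s), Sum.inr ⁻¹' (graftIso t r ⁻¹' s))
  invFun p := (graftIso t r).symm ⁻¹' (Sum.inl '' p.1 ∪ Sum.inr '' p.2)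
  left_inv s := by
    ext v
    obtain ⟨x | x, rfl⟩ := (graftIso t r).surjective v <;> simp
  right_inv p := by
    ext v <;> simp

theorem isIndepSet_graft_iff {t r : OrderedTree} {s : Set (Vertex (graft t r))} :
    (graph (graft t r)).IsIndepSet s ↔ (graph t).IsIndepSet (graftSetEquiv t r s).1 ∧
      (graph r).IsIndepSet (graftSetEquiv t r s).2 ∧
      ¬ (rootVertex t ∈ (graftSetEquiv t r s).1 ∧ rootVertex r ∈ (graftSetEquiv t r s).2) := by
  rw [← (graftIso t r).isIndepSet_preimage_iff, SimpleGraph.isIndepSet_joinAt_iff]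
  rfl

theorem rootVertex_graft_mem_iff {t r : OrderedTree} {s : Set (Vertex (graft t r))} :
    rootVertex (graft t r) ∈ s ↔ rootVertex r ∈ (graftSetEquiv t r s).2 := by
  rw [← graftIso_inr_root]
  rfl

theorem sigmaTwo_graft (t r : OrderedTree) : sigmaTwo (graft t r) = sigma t * sigmaTwo r := by
  unfold sigmaTwo sigma
  rw [← Set.ncard_prod]
  refine Set.ncard_congr' ((graftSetEquiv t r).subtypeEquiv fun s => ?_)
  simp only [Set.mem_ofPred_eq, Set.mem_prod, isIndepSet_graft_iff, rootVertex_graft_mem_iff]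
  tauto

theorem sigmaOne_graft (t r : OrderedTree) : sigmaOne (graft t r) = sigmaTwo t * sigmaOne r := by
  unfold sigmaOne sigmaTwo
  rw [← Set.ncard_prod]
  refine Set.ncard_congr' ((graftSetEquiv t r).subtypeEquiv fun s => ?_)
  simp only [Set.mem_ofPred_eq, Set.mem_prod, isIndepSet_graft_iff, rootVertex_graft_mem_iff]
  tauto

theorem sigmaTwo_leaf : sigmaTwo leaf = 1 := by
  refine Set.ncard_eq_one.2 ⟨∅, ?_⟩
  ext s
  simp only [Set.mem_ofPred_eq, Set.mem_singleton_iff]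
  constructor
  · rintro ⟨-, h⟩
    exact Set.eq_empty_of_forall_notMem fun v hv => h (Subsingleton.elim v (rootVertex leaf) ▸ hv)
  · rintro rfl
    simp

theorem sigmaOne_leaf : sigmaOne leaf = 1 := by
  refine Set.ncard_eq_one.2 ⟨Set.univ, ?_⟩
  ext s
  simp only [Set.mem_ofPred_eq, Set.mem_singleton_iff]
  constructor
  · rintro ⟨-, h⟩
    exact Set.eq_univ_of_forall fun v => Subsingleton.elim (rootVertex leaf) v ▸ h
  · rintro rfl
    exact ⟨Set.subsingleton_of_subsingleton.pairwise _, Set.mem_univ _⟩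

theorem rootDist_le (t : OrderedTree) : rootDist t ≤ size t ^ 2 := by
  induction t using graft_induction with
  | hl => simp [rootDist_leaf]
  | hg t r ht hr =>
    rw [rootDist_graft, size_graft]
    have h1 := size_pos t
    have h2 := size_pos r
    nlinarith

theorem wiener_le (t : OrderedTree) : wiener t ≤ size t ^ 3 := by
  induction t using graft_induction with
  | hl => simp [wiener_leaf]
  | hg t r ht hr =>
    rw [wiener_graft, size_graft]
    have h1 := size_pos t
    have h2 := size_pos r
    have h3 := Nat.mul_le_mul_right (size r) (rootDist_le t)
    have h4 := Nat.mul_le_mul_left (size t) (rootDist_le r)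
    have h5 : size t * size r ≤ size t ^ 2 * size r := Nat.mul_le_mul_right _ (by nlinarith)
    nlinarith

end OrderedTree

/-! ### The number of trees -/

namespace OrderedTree

theorem treesOfSize_one : treesOfSize 1 = {leaf} := by
  ext t
  rw [mem_treesOfSize, Finset.mem_singleton]
  refine ⟨fun h => ?_, fun h => h ▸ size_leaf⟩
  obtain ⟨_ | ⟨u, r⟩, rfl⟩ := graftEquiv.surjective t
  · rfl
  · have h1 := size_pos u
    have h2 := size_pos r
    simp only [graftEquiv_some, size_graft] at h
    omega

/-- Grafting a tree with `i + 1` vertices onto a tree with `j + 1` vertices, where `i + j = n`,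
gives each tree with `n + 2` vertices once. -/
theorem card_treesOfSize_add_two (n : ℕ) :
    (treesOfSize (n + 2)).card = ∑ p ∈ Finset.HasAntidiagonal.antidiagonal n,
      (treesOfSize (p.1 + 1)).card * (treesOfSize (p.2 + 1)).card := by
  simp_rw [← Finset.card_product]
  rw [← Finset.card_sigma]
  symm
  refine Finset.card_bij (fun q _ => graft q.2.1 q.2.2) ?_ ?_ ?_
  · rintro ⟨⟨i, j⟩, ⟨t, r⟩⟩ h
    simp only [Finset.mem_sigma, Finset.HasAntidiagonal.mem_antidiagonal, Finset.mem_product,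
      mem_treesOfSize] at h
    rw [mem_treesOfSize, size_graft]
    simp only
    omega
  · rintro ⟨⟨i, j⟩, ⟨t, r⟩⟩ h ⟨⟨i', j'⟩, ⟨t', r'⟩⟩ h' heq
    have := graftEquiv.injective (a₁ := some (t, r)) (a₂ := some (t', r')) heq
    simp only [Option.some.injEq, Prod.mk.injEq] at this
    obtain ⟨rfl, rfl⟩ := this
    simp only [Finset.mem_sigma, Finset.HasAntidiagonal.mem_antidiagonal, Finset.mem_product,
      mem_treesOfSize] at h h'
    obtain rfl : i = i' := by omega
    obtain rfl : j = j' := by omega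
    rfl
  · intro t ht
    rw [mem_treesOfSize] at ht
    obtain ⟨_ | ⟨u, r⟩, rfl⟩ := graftEquiv.surjective t
    · rw [graftEquiv_none, size_leaf] at ht
      omega
    · rw [graftEquiv_some, size_graft] at ht
      have h1 := size_pos u
      have h2 := size_pos r
      refine ⟨⟨(size u - 1, size r - 1), (u, r)⟩, ?_, rfl⟩
      simp only [Finset.mem_sigma, Finset.HasAntidiagonal.mem_antidiagonal, Finset.mem_product,
        mem_treesOfSize]
      simp only at ht
      omega

theorem card_treesOfSize_succ (n : ℕ) : (treesOfSize (n + 1)).card = catalan n := by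
  induction n using Nat.strong_induction_on with
  | _ n ih =>
    cases n with
    | zero => simp [treesOfSize_one]
    | succ n =>
      rw [card_treesOfSize_add_two, catalan_succ']
      refine Finset.sum_congr rfl fun p hp => ?_
      rw [Finset.HasAntidiagonal.mem_antidiagonal] at hp
      rw [ih p.1 (by omega), ih p.2 (by omega)]

theorem _root_.Nat.centralBinom_isEquivalent :
    (fun n : ℕ => (n.centralBinom : ℝ)) ~[atTop]
      fun n : ℕ => (4 : ℝ) ^ n / Real.sqrt (Real.pi * n) := by
  have h1 := Stirling.factorial_isEquivalent_stirling
  have h2 : (fun n : ℕ => ((2 * n).factorial : ℝ)) ~[atTop] fun n : ℕ =>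
      Real.sqrt (2 * (2 * n : ℕ) * Real.pi) * ((2 * n : ℕ) / Real.exp 1) ^ (2 * n) :=
    h1.comp_tendsto (tendsto_id.const_mul_atTop' (by norm_num : 0 < 2))
  refine ((h2.div (h1.mul h1)).congr_left ?_).congr_right ?_
  · refine Eventually.of_forall fun n => ?_
    have h := Nat.choose_mul_factorial_mul_factorial (show n ≤ 2 * n by omega)
    rw [show 2 * n - n = n by omega, ← Nat.centralBinom_eq_two_mul_choose] at h
    have h' : ((2 * n).factorial : ℝ) = n.centralBinom * n.factorial * n.factorial := by
      exact_mod_cast h.symm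
    have hne : (n.factorial : ℝ) ≠ 0 := by positivity
    simp only [Pi.div_apply, Pi.mul_apply, h']
    field_simp
  · filter_upwards [eventually_gt_atTop 0] with n hn
    have hn' : (0 : ℝ) < n := by exact_mod_cast hn
    have hpi := Real.pi_pos
    simp only [Pi.div_apply, Pi.mul_apply]
    push_cast
    rw [show (2 : ℝ) * (2 * n) * Real.pi = 2 ^ 2 * (Real.pi * n) by ring,
      Real.sqrt_mul (by positivity), Real.sqrt_sq (by norm_num),
      show (2 : ℝ) * n * Real.pi = 2 * (Real.pi * n) by ring]
    rw [mul_mul_mul_comm, Real.mul_self_sqrt (by positivity)]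
    have h3 := Real.sq_sqrt (show 0 ≤ Real.pi * n by positivity)
    have h4 : 0 < Real.sqrt (Real.pi * n) := Real.sqrt_pos.2 (by positivity)
    generalize Real.sqrt (Real.pi * n) = s at h3 h4
    have h5 : 0 < (n : ℝ) / Real.exp 1 := by positivity
    rw [← h3, mul_div_assoc 2 (n : ℝ), mul_pow, pow_mul (2 : ℝ) 2 n, ← pow_add, ← two_mul]
    field_simp
    norm_num

/-- The number of rooted ordered trees on `n` vertices is a Catalan number, and so it grows like
`4 ^ n / (4 √π n ^ (3 / 2))`. -/
theorem card_treesOfSize_isEquivalent :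
    (fun n : ℕ => ((treesOfSize n).card : ℝ)) ~[atTop]
      fun n : ℕ => (4 : ℝ) ^ n / (4 * Real.sqrt Real.pi * (n : ℝ) ^ (3 / 2 : ℝ)) := by
  have hq : (fun n : ℕ => (4 * (n : ℝ) - 2)) ~[atTop] fun n : ℕ => 4 * (n : ℝ) := by
    refine IsEquivalent.sub_isLittleO (v := fun n : ℕ => 4 * (n : ℝ)) IsEquivalent.refl
      (isLittleO_const_left.2 (.inr ?_))
    exact tendsto_norm_atTop_atTop.comp
      (tendsto_natCast_atTop_atTop.const_mul_atTop (by norm_num))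
  refine ((Nat.centralBinom_isEquivalent.div hq).congr_left ?_).congr_right ?_
  · filter_upwards [eventually_gt_atTop 0] with n hn
    obtain ⟨m, rfl⟩ := Nat.exists_eq_succ_of_ne_zero hn.ne'
    have h1 := Nat.succ_mul_centralBinom_succ m
    have h2 := succ_mul_catalan_eq_centralBinom m
    have h1' : ((m : ℝ) + 1) * (m + 1).centralBinom = 2 * (2 * m + 1) * m.centralBinom := by
      exact_mod_cast h1
    have h2' : ((m : ℝ) + 1) * catalan m = m.centralBinom := by exact_mod_cast h2
    have hm : (0 : ℝ) < m + 1 := by positivity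
    have hm' : (4 * ((m : ℝ) + 1) - 2) ≠ 0 := by
      have : (0 : ℝ) ≤ m := by positivity
      linarith
    simp only [Pi.div_apply, Nat.succ_eq_add_one, card_treesOfSize_succ]
    push_cast
    rw [div_eq_iff hm']
    refine mul_left_cancel₀ hm.ne' ?_
    rw [h1', ← h2']
    ring
  · filter_upwards [eventually_gt_atTop 0] with n hn
    have hn' : (0 : ℝ) < n := by exact_mod_cast hn
    simp only [Pi.div_apply]
    rw [Real.sqrt_mul Real.pi_pos.le, show (3 / 2 : ℝ) = 1 + 1 / 2 by norm_num,
      Real.rpow_add hn', Real.rpow_one, ← Real.sqrt_eq_rpow, div_div]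
    congr 1
    ring

end OrderedTree

/-! ### Convergence of the generating functions -/

namespace OrderedTree

/-- For `x = 4 / 27` the partial sums of the generating functions of `sigmaTwo` and `sigmaOne` stay
below `1 / 3` and `2 / 9`: these numbers solve `a = x + (a + b) a`, `b = x + a b`. -/
theorem sum_sigma_le (n : ℕ) (F : Finset OrderedTree) (hF : ∀ t ∈ F, size t ≤ n) :
    ∑ t ∈ F, (sigmaTwo t : ℝ) * (4 / 27) ^ size t ≤ 1 / 3 ∧
      ∑ t ∈ F, (sigmaOne t : ℝ) * (4 / 27) ^ size t ≤ 2 / 9 := by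
  classical
  induction n generalizing F with
  | zero =>
    have : F = ∅ := Finset.eq_empty_of_forall_notMem fun t ht =>
      (size_pos t).ne' (Nat.le_zero.1 (hF t ht))
    subst this
    norm_num
  | succ n ih =>
    set A : Finset OrderedTree := (finite_size_le n).toFinset with hA
    obtain ⟨h2, h1⟩ := ih A fun t ht => by simpa [hA] using ht
    have hsub : F ⊆ (Finset.insertNone (A ×ˢ A)).map graftEquiv.toEmbedding := by
      intro t ht
      have h := hF t ht
      obtain ⟨_ | ⟨u, r⟩, rfl⟩ := graftEquiv.surjective t
      · exact Finset.mem_map_of_mem _ (Finset.none_mem_insertNone)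
      · refine Finset.mem_map_of_mem _ (Finset.some_mem_insertNone.2 ?_)
        simp only [graftEquiv_some, size_graft] at h
        have hu := size_pos u
        have hr := size_pos r
        simp only [Finset.mem_product, hA, Set.Finite.mem_toFinset, Set.mem_ofPred_eq]
        omega
    have key : ∀ f : OrderedTree → ℕ, ∑ t ∈ F, (f t : ℝ) * (4 / 27) ^ size t ≤
        f leaf * (4 / 27) +
          ∑ t ∈ A, ∑ r ∈ A, (f (graft t r) : ℝ) * (4 / 27) ^ (size t + size r) := by
      intro f
      refine (Finset.sum_le_sum_of_subset_of_nonneg hsub fun t _ _ => by positivity).trans_eq ?_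
      rw [Finset.sum_map, Finset.sum_insertNone, ← Finset.sum_product']
      simp [size_leaf, size_graft]
    constructor
    · refine (key _).trans ?_
      have h : ∑ t ∈ A, ∑ r ∈ A, (sigmaTwo (graft t r) : ℝ) * (4 / 27) ^ (size t + size r) =
          (∑ t ∈ A, (sigmaOne t : ℝ) * (4 / 27) ^ size t +
            ∑ t ∈ A, (sigmaTwo t : ℝ) * (4 / 27) ^ size t) *
          ∑ t ∈ A, (sigmaTwo t : ℝ) * (4 / 27) ^ size t := by
        rw [← Finset.sum_add_distrib, Finset.sum_mul_sum]
        refine Finset.sum_congr rfl fun t _ => Finset.sum_congr rfl fun r _ => ?_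
        rw [sigmaTwo_graft, sigma_eq_add]
        push_cast
        ring
      rw [h, sigmaTwo_leaf]
      have h0 : 0 ≤ ∑ t ∈ A, (sigmaTwo t : ℝ) * (4 / 27) ^ size t :=
        Finset.sum_nonneg fun t _ => by positivity
      have := mul_le_mul (add_le_add h1 h2) h2 h0 (by norm_num)
      norm_num at this ⊢
      linarith
    · refine (key _).trans ?_
      have h : ∑ t ∈ A, ∑ r ∈ A, (sigmaOne (graft t r) : ℝ) * (4 / 27) ^ (size t + size r) =
          (∑ t ∈ A, (sigmaTwo t : ℝ) * (4 / 27) ^ size t) *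
          ∑ t ∈ A, (sigmaOne t : ℝ) * (4 / 27) ^ size t := by
        rw [Finset.sum_mul_sum]
        refine Finset.sum_congr rfl fun t _ => Finset.sum_congr rfl fun r _ => ?_
        rw [sigmaOne_graft]
        push_cast
        ring
      rw [h, sigmaOne_leaf]
      have h0 : 0 ≤ ∑ t ∈ A, (sigmaOne t : ℝ) * (4 / 27) ^ size t :=
        Finset.sum_nonneg fun t _ => by positivity
      have := mul_le_mul h2 h1 h0 (by norm_num)
      norm_num at this ⊢
      linarith

theorem sum_sigmaTwo_le (F : Finset OrderedTree) :
    ∑ t ∈ F, (sigmaTwo t : ℝ) * (4 / 27) ^ size t ≤ 1 / 3 :=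
  (sum_sigma_le (F.sup size) F fun _ ht => Finset.le_sup ht).1

theorem sum_sigmaOne_le (F : Finset OrderedTree) :
    ∑ t ∈ F, (sigmaOne t : ℝ) * (4 / 27) ^ size t ≤ 2 / 9 :=
  (sum_sigma_le (F.sup size) F fun _ ht => Finset.le_sup ht).2

theorem summable_sigmaTwo : Summable fun t => (sigmaTwo t : ℝ) * (4 / 27) ^ size t :=
  summable_of_sum_le (fun _ => by positivity) sum_sigmaTwo_le

theorem summable_sigma : Summable fun t => (sigma t : ℝ) * (4 / 27) ^ size t := by
  refine ((summable_of_sum_le (fun _ => by positivity) sum_sigmaOne_le).add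
    summable_sigmaTwo).congr fun t => ?_
  rw [sigma_eq_add]
  push_cast
  ring

/-- The generating function of the tree parameter `f`. -/
noncomputable def gf (f : OrderedTree → ℕ) (z : ℂ) : ℂ := ∑' t, (f t : ℂ) * z ^ size t

/-- A polynomial factor in the number of vertices does not affect convergence in the open disc. -/
theorem summable_gf {f : OrderedTree → ℕ} (hf : ∀ t, f t ≤ size t ^ 3 * sigma t) {z : ℂ}
    (hz : ‖z‖ < 4 / 27) : Summable fun t => (f t : ℂ) * z ^ size t := by
  have hr : |‖z‖ / (4 / 27)| < 1 := by
    rw [abs_of_nonneg (by positivity)]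
    exact (div_lt_one (by norm_num)).2 hz
  obtain ⟨C, hC⟩ := (tendsto_pow_const_mul_const_pow_of_abs_lt_one 3 hr).bddAbove_range
  refine Summable.of_norm_bounded (summable_sigma.mul_left C) fun t => ?_
  have h1 : (size t : ℝ) ^ 3 * (‖z‖ / (4 / 27)) ^ size t ≤ C := hC ⟨size t, rfl⟩
  have h2 : (f t : ℝ) ≤ size t ^ 3 * sigma t := by exact_mod_cast hf t
  rw [norm_mul, norm_pow, Complex.norm_natCast]
  calc (f t : ℝ) * ‖z‖ ^ size t ≤ (size t ^ 3 * sigma t) * ‖z‖ ^ size t := by gcongr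
    _ = ((size t : ℝ) ^ 3 * (‖z‖ / (4 / 27)) ^ size t) * (sigma t * (4 / 27) ^ size t) := by
      rw [div_pow]
      field_simp
    _ ≤ C * (sigma t * (4 / 27) ^ size t) := by gcongr

theorem hasSum_gf {f : OrderedTree → ℕ} (hf : ∀ t, f t ≤ size t ^ 3 * sigma t) {z : ℂ}
    (hz : ‖z‖ < 4 / 27) : HasSum (fun t => (f t : ℂ) * z ^ size t) (gf f z) :=
  (summable_gf hf hz).hasSum

theorem norm_gf_sigmaTwo_le {z : ℂ} (hz : ‖z‖ < 4 / 27) : ‖gf sigmaTwo z‖ ≤ 1 / 3 := by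
  have h := summable_sigmaTwo.tsum_le_of_sum_le sum_sigmaTwo_le
  refine (tsum_of_norm_bounded summable_sigmaTwo.hasSum fun t => ?_).trans h
  rw [norm_mul, norm_pow, Complex.norm_natCast]
  gcongr

theorem hasSum_gf_mul_gf {f g : OrderedTree → ℕ} (hf : ∀ t, f t ≤ size t ^ 3 * sigma t)
    (hg : ∀ t, g t ≤ size t ^ 3 * sigma t) {z : ℂ} (hz : ‖z‖ < 4 / 27) :
    HasSum (fun p : OrderedTree × OrderedTree =>
      ((f p.1 : ℂ) * z ^ size p.1) * ((g p.2 : ℂ) * z ^ size p.2)) (gf f z * gf g z) :=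
by
  have h := summable_mul_of_summable_norm (summable_gf hf hz).norm (summable_gf hg hz).norm
  have h' := (hasSum_gf hf hz).mul (hasSum_gf hg hz) h
  exact h'

/-- A sum over all trees splits according to the decomposition into the single vertex and the
grafted trees. -/
theorem hasSum_of_hasSum_graft {f : OrderedTree → ℂ} {s : ℂ}
    (h : HasSum (fun p : OrderedTree × OrderedTree => f (graft p.1 p.2)) s) :
    HasSum f (f leaf + s) := by
  rw [← graftEquiv.hasSum_iff, ← (Equiv.optionEquivSumPUnit.{0} _).symm.hasSum_iff, add_comm]
  exact HasSum.sum (f := (f ∘ graftEquiv) ∘ (Equiv.optionEquivSumPUnit _).symm) h (hasSum_unique _)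

theorem gf_eq_of_graft {f : OrderedTree → ℕ} (hf : ∀ t, f t ≤ size t ^ 3 * sigma t) {z s : ℂ}
    (hz : ‖z‖ < 4 / 27) {k : OrderedTree × OrderedTree → ℂ} (hk : HasSum k s)
    (h : ∀ t r, (f (graft t r) : ℂ) * z ^ (size t + size r) = k (t, r)) :
    gf f z = f leaf * z + s := by
  refine (hasSum_gf hf hz).unique ?_
  have := hasSum_of_hasSum_graft (f := fun t => (f t : ℂ) * z ^ size t) (s := s) ?_
  · simpa [size_leaf] using this
  · simpa [size_graft, h] using hk

end OrderedTree

/-! ### The functional equations -/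

namespace OrderedTree

theorem sigmaOne_le (t : OrderedTree) : sigmaOne t ≤ sigma t := by rw [sigma_eq_add]; omega

theorem sigmaTwo_le (t : OrderedTree) : sigmaTwo t ≤ sigma t := by rw [sigma_eq_add]; omega

theorem weight_le {p : OrderedTree → ℕ} {k : ℕ} (hk : k ≤ 3) (hp : ∀ t, p t ≤ size t ^ k)
    {w : OrderedTree → ℕ} (hw : ∀ t, w t ≤ sigma t) (t : OrderedTree) :
    p t * w t ≤ size t ^ 3 * sigma t :=
  Nat.mul_le_mul ((hp t).trans (Nat.pow_le_pow_right (size_pos t) hk)) (hw t)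

theorem one_weight_le {w : OrderedTree → ℕ} (hw : ∀ t, w t ≤ sigma t) (t : OrderedTree) :
    w t ≤ size t ^ 3 * sigma t := by
  simpa using weight_le (p := fun _ => 1) (k := 0) (by norm_num) (by simp) hw t

theorem size_weight_le {w : OrderedTree → ℕ} (hw : ∀ t, w t ≤ sigma t) (t : OrderedTree) :
    size t * w t ≤ size t ^ 3 * sigma t :=
  weight_le (k := 1) (by norm_num) (by simp) hw t

theorem rootDist_weight_le {w : OrderedTree → ℕ} (hw : ∀ t, w t ≤ sigma t) (t : OrderedTree) :
    rootDist t * w t ≤ size t ^ 3 * sigma t :=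
  weight_le (by norm_num) rootDist_le hw t

theorem wiener_weight_le {w : OrderedTree → ℕ} (hw : ∀ t, w t ≤ sigma t) (t : OrderedTree) :
    wiener t * w t ≤ size t ^ 3 * sigma t :=
  weight_le le_rfl wiener_le hw t

theorem gf_mul_sigma {p : OrderedTree → ℕ} (hp : ∀ t, p t ≤ size t ^ 3) {z : ℂ}
    (hz : ‖z‖ < 4 / 27) : gf (fun t => p t * sigma t) z =
      gf (fun t => p t * sigmaOne t) z + gf (fun t => p t * sigmaTwo t) z := by
  refine (hasSum_gf (weight_le le_rfl hp fun _ => le_rfl) hz).unique ?_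
  refine ((hasSum_gf (weight_le le_rfl hp sigmaOne_le) hz).add
    (hasSum_gf (weight_le le_rfl hp sigmaTwo_le) hz)).congr_fun fun t => ?_
  rw [sigma_eq_add]
  push_cast
  ring

/-- Let `w` be multiplicative with respect to grafting: `w (graft t r) = w₁ t * w₂ r`, and
`w leaf = 1`. This is the functional equation of its generating function. -/
theorem gf_multiplicative {w w₁ w₂ : OrderedTree → ℕ} (hw : ∀ t, w t ≤ sigma t)
    (hw₁ : ∀ t, w₁ t ≤ sigma t) (hw₂ : ∀ t, w₂ t ≤ sigma t) (hl : w leaf = 1)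
    (hg : ∀ t r, w (graft t r) = w₁ t * w₂ r) {z : ℂ} (hz : ‖z‖ < 4 / 27) :
    gf w z = z + gf w₁ z * gf w₂ z := by
  rw [gf_eq_of_graft (one_weight_le hw) hz
    (hasSum_gf_mul_gf (one_weight_le hw₁) (one_weight_le hw₂) hz), hl]
  · simp
  · intro t r
    rw [hg]
    push_cast
    ring

theorem gf_size_multiplicative {w w₁ w₂ : OrderedTree → ℕ} (hw : ∀ t, w t ≤ sigma t)
    (hw₁ : ∀ t, w₁ t ≤ sigma t) (hw₂ : ∀ t, w₂ t ≤ sigma t) (hl : w leaf = 1)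
    (hg : ∀ t r, w (graft t r) = w₁ t * w₂ r) {z : ℂ} (hz : ‖z‖ < 4 / 27) :
    gf (fun t => size t * w t) z = z + (gf (fun t => size t * w₁ t) z * gf w₂ z +
      gf w₁ z * gf (fun t => size t * w₂ t) z) := by
  rw [gf_eq_of_graft (size_weight_le hw) hz
    ((hasSum_gf_mul_gf (size_weight_le hw₁) (one_weight_le hw₂) hz).add
      (hasSum_gf_mul_gf (one_weight_le hw₁) (size_weight_le hw₂) hz)), hl, size_leaf]
  · simp
  · intro t r
    rw [hg, size_graft]
    push_cast
    ring

theorem gf_rootDist_multiplicative {w w₁ w₂ : OrderedTree → ℕ} (hw : ∀ t, w t ≤ sigma t)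
    (hw₁ : ∀ t, w₁ t ≤ sigma t) (hw₂ : ∀ t, w₂ t ≤ sigma t)
    (hg : ∀ t r, w (graft t r) = w₁ t * w₂ r) {z : ℂ} (hz : ‖z‖ < 4 / 27) :
    gf (fun t => rootDist t * w t) z = gf (fun t => rootDist t * w₁ t) z * gf w₂ z +
      gf w₁ z * gf (fun t => rootDist t * w₂ t) z + gf (fun t => size t * w₁ t) z * gf w₂ z := by
  rw [gf_eq_of_graft (rootDist_weight_le hw) hz
    (((hasSum_gf_mul_gf (rootDist_weight_le hw₁) (one_weight_le hw₂) hz).add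
      (hasSum_gf_mul_gf (one_weight_le hw₁) (rootDist_weight_le hw₂) hz)).add
      (hasSum_gf_mul_gf (size_weight_le hw₁) (one_weight_le hw₂) hz)), rootDist_leaf]
  · simp
  · intro t r
    rw [hg, rootDist_graft]
    push_cast
    ring

theorem gf_wiener_multiplicative {w w₁ w₂ : OrderedTree → ℕ} (hw : ∀ t, w t ≤ sigma t)
    (hw₁ : ∀ t, w₁ t ≤ sigma t) (hw₂ : ∀ t, w₂ t ≤ sigma t)
    (hg : ∀ t r, w (graft t r) = w₁ t * w₂ r) {z : ℂ} (hz : ‖z‖ < 4 / 27) :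
    gf (fun t => wiener t * w t) z = gf (fun t => wiener t * w₁ t) z * gf w₂ z +
      gf w₁ z * gf (fun t => wiener t * w₂ t) z +
      gf (fun t => rootDist t * w₁ t) z * gf (fun t => size t * w₂ t) z +
      gf (fun t => size t * w₁ t) z * gf (fun t => rootDist t * w₂ t) z +
      gf (fun t => size t * w₁ t) z * gf (fun t => size t * w₂ t) z := by
  rw [gf_eq_of_graft (wiener_weight_le hw) hz
    (((((hasSum_gf_mul_gf (wiener_weight_le hw₁) (one_weight_le hw₂) hz).add
      (hasSum_gf_mul_gf (one_weight_le hw₁) (wiener_weight_le hw₂) hz)).add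
      (hasSum_gf_mul_gf (rootDist_weight_le hw₁) (size_weight_le hw₂) hz)).add
      (hasSum_gf_mul_gf (size_weight_le hw₁) (rootDist_weight_le hw₂) hz)).add
      (hasSum_gf_mul_gf (size_weight_le hw₁) (size_weight_le hw₂) hz)), wiener_leaf]
  · simp
  · intro t r
    rw [hg, wiener_graft]
    push_cast
    ring

theorem gf_sigma {z : ℂ} (hz : ‖z‖ < 4 / 27) :
    gf sigma z = gf sigmaOne z + gf sigmaTwo z := by
  simpa using gf_mul_sigma (p := fun _ => 1) (fun t => Nat.one_le_pow _ _ (size_pos t)) hz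

theorem gf_sigmaTwo_ne_one {z : ℂ} (hz : ‖z‖ < 4 / 27) : 1 - gf sigmaTwo z ≠ 0 := by
  intro h
  have h1 := norm_gf_sigmaTwo_le hz
  rw [← sub_eq_zero.1 h] at h1
  norm_num at h1

theorem gf_sigmaOne {z : ℂ} (hz : ‖z‖ < 4 / 27) :
    gf sigmaOne z = gf sigmaTwo z * (1 - gf sigmaTwo z) := by
  have h1 := gf_multiplicative sigmaOne_le sigmaTwo_le sigmaOne_le sigmaOne_leaf
    sigmaOne_graft hz
  have h2 := gf_multiplicative sigmaTwo_le (fun t => le_rfl) sigmaTwo_le sigmaTwo_leaf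
    sigmaTwo_graft hz
  rw [gf_sigma hz] at h2
  linear_combination h1 - h2

theorem gf_sigmaTwo_cubic {z : ℂ} (hz : ‖z‖ < 4 / 27) :
    gf sigmaTwo z * (1 - gf sigmaTwo z) ^ 2 = z := by
  have h1 := gf_multiplicative sigmaOne_le sigmaTwo_le sigmaOne_le sigmaOne_leaf
    sigmaOne_graft hz
  rw [gf_sigmaOne hz] at h1
  linear_combination h1

theorem gf_sigmaTwo_ne_third {z : ℂ} (hz : ‖z‖ < 4 / 27) : 1 - 3 * gf sigmaTwo z ≠ 0 := by
  intro h
  have h1 := gf_sigmaTwo_cubic hz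
  have h2 : gf sigmaTwo z = 1 / 3 := by linear_combination -h / 3
  rw [h2] at h1
  rw [← h1] at hz
  norm_num at hz

/-- The rational function that expresses the generating function of `wiener * sigma` in terms of
that of `sigmaTwo`. -/
noncomputable def wienerRat (s : ℂ) : ℂ :=
  (3 * s ^ 2 - 17 * s ^ 3 + 39 * s ^ 4 - 45 * s ^ 5 + 25 * s ^ 6 - 3 * s ^ 7 - 3 * s ^ 8 + s ^ 9) /
    ((1 - 3 * s) ^ 4 * (1 - s) ^ 3)

/-- The functional equations form three linear systems, one each for the weights `size`, `rootDist`
and `wiener`, with determinant a multiple of `1 - 3 s`; this is the solution of the last one. -/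
theorem gf_wiener_sigma {z : ℂ} (hz : ‖z‖ < 4 / 27) :
    gf (fun t => wiener t * sigma t) z = wienerRat (gf sigmaTwo z) := by
  have hσ : ∀ t, sigma t ≤ sigma t := fun _ => le_rfl
  have hP := gf_mul_sigma (p := size) (fun t => Nat.le_self_pow (by norm_num) _) hz
  have hP2 := gf_size_multiplicative sigmaTwo_le hσ sigmaTwo_le sigmaTwo_leaf sigmaTwo_graft hz
  have hP1 := gf_size_multiplicative sigmaOne_le sigmaTwo_le sigmaOne_le sigmaOne_leaf
    sigmaOne_graft hz
  have hD := gf_mul_sigma (p := rootDist) (fun t => (rootDist_le t).trans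
    (Nat.pow_le_pow_right (size_pos t) (by norm_num))) hz
  have hD2 := gf_rootDist_multiplicative sigmaTwo_le hσ sigmaTwo_le sigmaTwo_graft hz
  have hD1 := gf_rootDist_multiplicative sigmaOne_le sigmaTwo_le sigmaOne_le sigmaOne_graft hz
  have hW := gf_mul_sigma (p := wiener) wiener_le hz
  have hW2 := gf_wiener_multiplicative sigmaTwo_le hσ sigmaTwo_le sigmaTwo_graft hz
  have hW1 := gf_wiener_multiplicative sigmaOne_le sigmaTwo_le sigmaOne_le sigmaOne_graft hz
  have hs1 := gf_sigmaTwo_ne_one hz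
  have hs3 := gf_sigmaTwo_ne_third hz
  have hc := gf_sigmaTwo_cubic hz
  rw [gf_sigma hz, gf_sigmaOne hz] at hP2 hD2 hW2
  rw [gf_sigmaOne hz] at hP1 hD1 hW1
  generalize gf (fun t => size t * sigma t) z = P at *
  generalize gf (fun t => size t * sigmaOne t) z = P1 at *
  generalize gf (fun t => size t * sigmaTwo t) z = P2 at *
  generalize gf (fun t => rootDist t * sigma t) z = D at *
  generalize gf (fun t => rootDist t * sigmaOne t) z = D1 at *
  generalize gf (fun t => rootDist t * sigmaTwo t) z = D2 at *
  generalize gf (fun t => wiener t * sigma t) z = W at *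
  generalize gf (fun t => wiener t * sigmaOne t) z = W1 at *
  generalize gf (fun t => wiener t * sigmaTwo t) z = W2 at *
  generalize gf sigmaTwo z = s at *
  subst hP hD hW hc
  have e1 : P1 = s * (1 - s) + s * P2 := mul_left_cancel₀ hs1 (by linear_combination hP1)
  have e2 : P2 = s * (1 - s) / (1 - 3 * s) := by
    rw [eq_div_iff hs3]
    linear_combination hP2 + s * e1
  have d1 : D1 = s * D2 + s * P2 := mul_left_cancel₀ hs1 (by linear_combination hD1)
  have d2 : D2 = s * (P1 + (1 + s) * P2) / (1 - 3 * s) := by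
    rw [eq_div_iff hs3]
    linear_combination hD2 + s * d1
  have e1' : P1 * (1 - 3 * s) = s * (1 - s) * (1 - 2 * s) := by
    rw [eq_div_iff hs3] at e2
    linear_combination (1 - 3 * s) * e1 + s * e2
  have d2' : D2 * (1 - 3 * s) ^ 2 = s ^ 2 * (1 - s) * (2 - s) := by
    rw [eq_div_iff hs3] at e2 d2
    linear_combination (1 - 3 * s) * d2 + s * e1' + s * (1 + s) * e2
  have d1' : D1 * (1 - 3 * s) ^ 2 = s ^ 2 * (1 - s) * (1 - s - s ^ 2) := by
    rw [eq_div_iff hs3] at e2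
    linear_combination (1 - 3 * s) ^ 2 * d1 + s * d2' + s * (1 - 3 * s) * e2
  rw [← eq_div_iff hs3] at e1'
  rw [← eq_div_iff (pow_ne_zero 2 hs3)] at d1' d2'
  -- eliminate first `W1`, then `W2`, from the last system
  have w : (W1 + W2) * ((1 - s) * (1 - 3 * s)) =
      (1 + s) * (s * (D2 * P1 + P2 * D1 + P2 * P1) +
        (1 - s) * ((D1 + D2) * P2 + (P1 + P2) * D2 + (P1 + P2) * P2)) +
      (1 - 3 * s) * (D2 * P1 + P2 * D1 + P2 * P1) := by
    linear_combination (s * (1 + s) + (1 - 3 * s)) * hW1 + (1 + s) * (1 - s) * hW2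
  rw [wienerRat, eq_div_iff (by positivity)]
  refine mul_left_cancel₀ (mul_ne_zero hs1 hs3) ?_
  rw [← mul_assoc, mul_comm _ (W1 + W2), w, d1', d2', e1', e2]
  field_simp
  ring

end OrderedTree

/-! ### An explicit solution of the cubic equation -/

namespace CubicBranch

open Complex

/-- If `p ^ 2 - 2 a p + 1 = 0` with `a` in the right half-plane, then `p` is not a real number
`≤ 0`. -/
theorem mem_slitPlane_of_add_inv {p a : ℂ} (hp : p * (2 * a - p) = 1) (ha : 0 < a.re) :
    p ∈ slitPlane := by
  rw [mem_slitPlane_iff]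
  by_contra! h
  obtain ⟨h1, h2⟩ := h
  have h3 := congrArg re hp
  simp only [mul_re, sub_re, sub_im, h2, zero_mul, sub_zero, one_re, re_ofNat, im_ofNat] at h3
  nlinarith [mul_nonneg (neg_nonneg.2 h1) ha.le, sq_nonneg p.re]

/-- The function `cosh ((2 / 3) log (a + b))`, where `a² - b² = 1`: if `a = cosh x` and
`b = sinh x` with `|Im x| < π`, this is `cosh (2 x / 3)`. -/
noncomputable def coshTwoThirds (a b : ℂ) : ℂ := cosh (2 / 3 * log (a + b))

theorem add_mem_slitPlane {a b : ℂ} (hab : a ^ 2 - b ^ 2 = 1) (ha : 0 < a.re) :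
    a + b ∈ slitPlane :=
  mem_slitPlane_of_add_inv (a := a) (by linear_combination hab) ha

/-- Replacing `b` by `-b` turns `a + b` into its inverse, and `cosh` is even. -/
theorem coshTwoThirds_neg {a b : ℂ} (hab : a ^ 2 - b ^ 2 = 1) (ha : 0 < a.re) :
    coshTwoThirds a (-b) = coshTwoThirds a b := by
  have hp := add_mem_slitPlane hab ha
  have h : a + -b = (a + b)⁻¹ :=
    eq_inv_of_mul_eq_one_left (by linear_combination hab)
  rw [coshTwoThirds, h, log_inv _ (mem_slitPlane_iff_arg.1 hp).1, mul_neg, cosh_neg, coshTwoThirds]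

/-- This is the triple angle formula for `cosh` at `(2 / 3) log (a + b)`, combined with
`cosh (log (a + b)) = a`. -/
theorem coshTwoThirds_cubic {a b : ℂ} (hab : a ^ 2 - b ^ 2 = 1) (ha : 0 < a.re) :
    4 * coshTwoThirds a b ^ 3 - 3 * coshTwoThirds a b = 2 * a ^ 2 - 1 := by
  have hp := slitPlane_ne_zero (add_mem_slitPlane hab ha)
  have hinv : (a + b)⁻¹ = a - b := inv_eq_of_mul_eq_one_right (by linear_combination hab)
  have hc : cosh (log (a + b)) = a := by
    rw [Complex.cosh, exp_neg, exp_log hp, hinv]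
    ring
  rw [coshTwoThirds, ← cosh_three_mul, show 3 * (2 / 3 * log (a + b)) = 2 * log (a + b) by ring,
    cosh_two_mul, sinh_sq, hc]
  ring

theorem sqrt_sq (x : ℂ) : sqrt x ^ 2 = x := by
  rw [sqrt]
  exact cpow_ofNat_inv_pow x 2

theorem re_sqrt_pos {x : ℂ} (hx : x ∈ slitPlane) : 0 < (sqrt x).re := by
  have h : 0 < ‖x‖ + x.re := by
    have h1 := neg_le_of_abs_le (abs_re_le_norm x)
    rcases mem_slitPlane_iff.1 hx with h | h
    · have := norm_nonneg x
      linarith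
    · have := neg_lt_of_abs_lt (abs_re_lt_norm.2 h)
      linarith
  rw [sqrt, cpow_inv_two_re]
  exact Real.sqrt_pos.2 (by linarith)

theorem continuousAt_sqrt_zero : ContinuousAt sqrt 0 :=
  continuousAt_cpow_const_of_re_pos (.inl le_rfl) (by norm_num)

/-- The plane slit along the real half-line from `4 / 27` on. -/
def domain : Set ℂ := {z | 1 - 27 * z / 4 ∈ slitPlane}

theorem isOpen_domain : IsOpen domain := isOpen_slitPlane.preimage (by fun_prop)

theorem zero_mem_domain : 0 ∈ domain := by simp [domain]

theorem mem_domain_iff {z : ℂ} : z ∈ domain ↔ ¬ (z.im = 0 ∧ 4 / 27 ≤ z.re) := by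
  have h : (1 - 27 * z / 4 : ℂ) = 1 - (27 / 4 : ℝ) * z := by
    push_cast
    ring
  rw [domain, Set.mem_ofPred_eq, mem_slitPlane_iff, h]
  simp only [sub_re, one_re, re_ofReal_mul, sub_im, one_im, im_ofReal_mul]
  constructor
  · rintro (h | h) ⟨h1, h2⟩
    · linarith
    · simp [h1] at h
  · intro h
    by_contra! h'
    obtain ⟨h1, h2⟩ := h'
    exact h ⟨by linarith, by linarith⟩

/-- The branch of the solution `s` of `s (1 - s)² = z` with value `0` at `z = 0`: the substitution
`s = (2 - 2 c) / 3` turns the equation into `4 c ^ 3 - 3 c = 2 y - 1` with `y = 1 - 27 z / 4`, which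
`c = cosh (2 x / 3)` solves if `cosh x ^ 2 = y`. -/
noncomputable def branch (z : ℂ) : ℂ :=
  (2 - 2 * coshTwoThirds (sqrt (1 - 27 * z / 4)) (sqrt (-(27 * z / 4)))) / 3

theorem sqrt_sq_sub_sqrt_sq (z : ℂ) :
    sqrt (1 - 27 * z / 4) ^ 2 - sqrt (-(27 * z / 4)) ^ 2 = 1 := by
  rw [sqrt_sq, sqrt_sq]
  ring

theorem branch_cubic {z : ℂ} (hz : z ∈ domain) : branch z * (1 - branch z) ^ 2 = z := by
  have h := coshTwoThirds_cubic (sqrt_sq_sub_sqrt_sq z) (re_sqrt_pos hz)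
  rw [sqrt_sq] at h
  rw [branch]
  linear_combination -2 / 27 * h

theorem branch_zero : branch 0 = 0 := by
  simp [branch, coshTwoThirds]

/-- The value of the branch does not depend on the choice of the second square root. -/
theorem branch_eq {z b : ℂ} (hz : z ∈ domain) (hb : b ^ 2 = -(27 * z / 4)) :
    branch z = (2 - 2 * coshTwoThirds (sqrt (1 - 27 * z / 4)) b) / 3 := by
  rw [branch]
  rcases sq_eq_sq_iff_eq_or_eq_neg.1 (hb.trans (sqrt_sq (-(27 * z / 4))).symm) with rfl | rfl
  · rfl
  · rw [coshTwoThirds_neg (sqrt_sq_sub_sqrt_sq z) (re_sqrt_pos hz)]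

theorem I_mul_sqrt_sq (z : ℂ) : (I * sqrt (27 * z / 4)) ^ 2 = -(27 * z / 4) := by
  rw [mul_pow, sqrt_sq, I_sq]
  ring

theorem differentiableAt_coshTwoThirds {f g : ℂ → ℂ} {z : ℂ} (hf : DifferentiableAt ℂ f z)
    (hg : DifferentiableAt ℂ g z) (h : f z + g z ∈ slitPlane) :
    DifferentiableAt ℂ (fun w => (2 - 2 * coshTwoThirds (f w) (g w)) / 3) z :=
  ((((((hf.add hg).clog h).const_mul (2 / 3)).ccosh).const_mul 2).const_sub 2).div_const 3

theorem continuousAt_coshTwoThirds {f g : ℂ → ℂ} {z : ℂ} (hf : ContinuousAt f z)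
    (hg : ContinuousAt g z) (h : f z + g z ∈ slitPlane) :
    ContinuousAt (fun w => (2 - 2 * coshTwoThirds (f w) (g w)) / 3) z := by
  have h1 : ContinuousAt (fun w => cosh (2 / 3 * log (f w + g w))) z :=
    continuous_cosh.continuousAt.comp (((hf.add hg).clog h).const_mul (2 / 3))
  exact ((h1.const_mul 2).const_sub 2).div_const 3

theorem differentiableAt_branch {z : ℂ} (hz : z ∈ domain) (h0 : z ≠ 0) :
    DifferentiableAt ℂ branch z := by
  have hne : (27 * z / 4 : ℂ) ≠ 0 := by simpa using h0
  have h1 : DifferentiableAt ℂ (fun w : ℂ => sqrt (1 - 27 * w / 4)) z :=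
    (differentiableAt_sqrt hz).comp z (f := fun w : ℂ => 1 - 27 * w / 4) (by fun_prop)
  rcases mem_slitPlane_or_neg_mem_slitPlane hne with h | h
  · -- here the second square root is taken to be `I * sqrt (27 z / 4)`
    have h2 : DifferentiableAt ℂ (fun w : ℂ => I * sqrt (27 * w / 4)) z :=
      ((differentiableAt_sqrt h).comp z (f := fun w : ℂ => 27 * w / 4) (by fun_prop)).const_mul I
    refine (differentiableAt_coshTwoThirds h1 h2 ?_).congr_of_eventuallyEq ?_
    · refine add_mem_slitPlane ?_ (re_sqrt_pos hz)
      rw [I_mul_sqrt_sq, sqrt_sq]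
      ring
    · filter_upwards [isOpen_domain.mem_nhds hz] with w hw
      exact branch_eq hw (I_mul_sqrt_sq w)
  · have h2 : DifferentiableAt ℂ (fun w : ℂ => sqrt (-(27 * w / 4))) z :=
      (differentiableAt_sqrt h).comp z (f := fun w : ℂ => -(27 * w / 4)) (by fun_prop)
    exact differentiableAt_coshTwoThirds h1 h2
      (add_mem_slitPlane (sqrt_sq_sub_sqrt_sq z) (re_sqrt_pos hz))

theorem continuousAt_branch_zero : ContinuousAt branch 0 := by
  refine continuousAt_coshTwoThirds ?_ ?_
    (add_mem_slitPlane (sqrt_sq_sub_sqrt_sq 0) (re_sqrt_pos zero_mem_domain))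
  · exact ((differentiableAt_sqrt zero_mem_domain).comp (0 : ℂ) (f := fun w : ℂ => 1 - 27 * w / 4)
      (by fun_prop)).continuousAt
  · refine ContinuousAt.comp (g := sqrt) (x := (0 : ℂ)) (f := fun w : ℂ => -(27 * w / 4)) ?_
      (by fun_prop)
    simpa using continuousAt_sqrt_zero

theorem branch_ne_third {z : ℂ} (hz : z ∈ domain) : 1 - 3 * branch z ≠ 0 := by
  intro h
  have h1 := branch_cubic hz
  have h2 : branch z = 1 / 3 := by linear_combination -h / 3
  rw [h2] at h1
  refine mem_domain_iff.1 hz ?_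
  rw [← h1]
  norm_num

theorem branch_ne_one {z : ℂ} (hz : z ∈ domain) : 1 - branch z ≠ 0 := by
  intro h
  have h1 := branch_cubic hz
  have h2 : z = 0 := by rw [← h1, h]; simp
  rw [h2, branch_zero] at h
  norm_num at h

theorem branch_ne_zero {z : ℂ} (hz : z ∈ domain) (h0 : z ≠ 0) : branch z ≠ 0 := by
  intro h
  have h1 := branch_cubic hz
  rw [h] at h1
  exact h0 (by simpa using h1.symm)

theorem differentiableOn_branch : DifferentiableOn ℂ branch domain :=
  (differentiableOn_compl_singleton_and_continuousAt_iff
    (isOpen_domain.mem_nhds zero_mem_domain)).1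
    ⟨fun _ hz => (differentiableAt_branch hz.1 hz.2).differentiableWithinAt,
      continuousAt_branch_zero⟩

theorem tendsto_branch : Tendsto branch (𝓝[domain] (4 / 27)) (𝓝 (1 / 3)) := by
  have h : ContinuousAt (fun w : ℂ =>
      (2 - 2 * coshTwoThirds (sqrt (1 - 27 * w / 4)) (I * sqrt (27 * w / 4))) / 3) (4 / 27) := by
    refine continuousAt_coshTwoThirds ?_ ?_ ?_
    · refine ContinuousAt.comp (g := sqrt) (x := (4 / 27 : ℂ)) (f := fun w : ℂ => 1 - 27 * w / 4) ?_
        (by fun_prop)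
      norm_num
      exact continuousAt_sqrt_zero
    · refine continuousAt_const.mul (ContinuousAt.comp (g := sqrt) (x := (4 / 27 : ℂ))
        (f := fun w : ℂ => 27 * w / 4) ?_ (by fun_prop))
      norm_num
      exact (differentiableAt_sqrt one_mem_slitPlane).continuousAt
    · norm_num [mem_slitPlane_iff]
  have hval : (2 - 2 * coshTwoThirds (sqrt (1 - 27 * (4 / 27) / 4))
      (I * sqrt (27 * (4 / 27) / 4))) / 3 = (1 / 3 : ℂ) := by
    have h1 : (2 / 3 * (Real.pi / 2 * I) : ℂ) = ((Real.pi / 3 : ℝ) : ℂ) * I := by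
      push_cast
      ring
    norm_num [coshTwoThirds, log_I]
    rw [h1, cosh_mul_I, ← ofReal_cos, Real.cos_pi_div_three]
    norm_num
  have h' := h.tendsto
  simp only [hval] at h'
  refine (h'.mono_left nhdsWithin_le_nhds).congr' ?_
  filter_upwards [self_mem_nhdsWithin] with w hw
  exact (branch_eq hw (I_mul_sqrt_sq w)).symm

theorem mem_domain_of_norm_lt {z : ℂ} (hz : ‖z‖ < 4 / 27) : z ∈ domain :=
  mem_domain_iff.2 fun h => absurd (h.2.trans (re_le_norm z)) hz.not_ge

/-- On the disc the branch stays in the disc of radius `1 / 3`, since it cannot cross the boundary: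
`‖s‖ = 1 / 3` implies `‖s (1 - s)²‖ ≥ (1 / 3) (2 / 3)² = 4 / 27`. -/
theorem norm_branch_lt {z : ℂ} (hz : ‖z‖ < 4 / 27) : ‖branch z‖ < 1 / 3 := by
  by_contra! h
  have hcont : ContinuousOn (fun w => ‖branch w‖) (Metric.ball 0 (4 / 27)) :=
    (differentiableOn_branch.continuousOn.mono fun w hw =>
      mem_domain_of_norm_lt (by simpa using hw)).norm
  obtain ⟨w, hw, hw'⟩ := (convex_ball (0 : ℂ) (4 / 27)).isPreconnected.intermediate_value
    (Metric.mem_ball_self (by norm_num)) (by simpa using hz) hcont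
    (show (1 / 3 : ℝ) ∈ Set.Icc _ _ from ⟨by simp [branch_zero], h⟩)
  have hw0 : ‖w‖ < 4 / 27 := by simpa using hw
  have h1 := congrArg norm (branch_cubic (mem_domain_of_norm_lt hw0))
  have hw' : ‖branch w‖ = 1 / 3 := hw'
  rw [norm_mul, norm_pow, hw'] at h1
  have h2 : 1 - 1 / 3 ≤ ‖1 - branch w‖ := by
    have := norm_sub_norm_le 1 (branch w)
    rwa [hw', norm_one] at this
  nlinarith

/-- The map `s ↦ s (1 - s)²` takes a value that it has in the open disc of radius `1 / 3` only once
in the closed disc: two different arguments `s`, `t` of a value satisfy `(1 - (s + t))² = s t`,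
where the left side has modulus greater than `1 / 9` and the right side has not. -/
theorem eq_of_cubic_eq {s t : ℂ} (h : s * (1 - s) ^ 2 = t * (1 - t) ^ 2) (hs : ‖s‖ < 1 / 3)
    (ht : ‖t‖ ≤ 1 / 3) : s = t := by
  have h1 : (s - t) * ((1 - (s + t)) ^ 2 - s * t) = 0 := by linear_combination h
  rcases mul_eq_zero.1 h1 with h2 | h2
  · exact sub_eq_zero.1 h2
  · exfalso
    have h3 : ‖1 - (s + t)‖ ^ 2 = ‖s‖ * ‖t‖ := by
      rw [← norm_pow, ← norm_mul, sub_eq_zero.1 h2]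
    have h4 : 1 - (‖s‖ + ‖t‖) ≤ ‖1 - (s + t)‖ := by
      have h5 := norm_sub_norm_le 1 (s + t)
      have h6 := norm_add_le s t
      rw [norm_one] at h5
      linarith
    have h7 : 1 / 3 < ‖1 - (s + t)‖ := by linarith
    have h8 : ‖s‖ * ‖t‖ ≤ 1 / 3 * (1 / 3) :=
      mul_le_mul hs.le ht (norm_nonneg t) (by norm_num)
    nlinarith

end CubicBranch

namespace OrderedTree

open CubicBranch

/-- In the disc of convergence the generating function of `sigmaTwo` is the explicit branch. -/
theorem gf_sigmaTwo_eq_branch {z : ℂ} (hz : ‖z‖ < 4 / 27) : gf sigmaTwo z = branch z :=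
  (eq_of_cubic_eq ((branch_cubic (mem_domain_of_norm_lt hz)).trans (gf_sigmaTwo_cubic hz).symm)
    (norm_branch_lt hz) (norm_gf_sigmaTwo_le hz)).symm

end OrderedTree

/-! ### Transfer of a growth bound to the coefficients -/

namespace UnitDisc

open Real Metric

theorem one_sub_ne_zero {w : ℂ} (hw : ‖w‖ < 1) : 1 - w ≠ 0 := by
  intro h
  rw [← sub_eq_zero.1 h, norm_one] at hw
  exact lt_irrefl _ hw

theorem continuousOn_inv_norm_sq {r : ℝ} (hr : |r| < 1) :
    ContinuousOn (fun w : ℂ => (‖1 - w‖ ^ 2)⁻¹) (sphere 0 |r|) := by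
  refine ContinuousOn.inv₀ (by fun_prop) fun w hw => ?_
  have : ‖w‖ < 1 := by rw [mem_sphere_zero_iff_norm.1 hw]; exact hr
  exact pow_ne_zero 2 (norm_ne_zero_iff.2 (one_sub_ne_zero this))

/-- On the circle of radius `r` the function `(1 - r²) / ‖1 - w‖²` is the real part of the
holomorphic function `(1 + w) / (1 - w)`, whose mean value is its value `1` at the centre. -/
theorem circleAverage_inv_norm_sq {r : ℝ} (h0 : 0 ≤ r) (hr : r < 1) :
    circleAverage (fun w : ℂ => (‖1 - w‖ ^ 2)⁻¹) 0 r = (1 - r ^ 2)⁻¹ := by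
  have habs : |r| < 1 := by rwa [abs_of_nonneg h0]
  have hr2 : 0 < 1 - r ^ 2 := by nlinarith
  have hne : ∀ w ∈ closedBall (0 : ℂ) |r|, 1 - w ≠ 0 := fun w hw =>
    one_sub_ne_zero ((mem_closedBall_zero_iff.1 hw).trans_lt habs)
  have hd : DifferentiableOn ℂ (fun w : ℂ => (1 + w) / (1 - w)) (closedBall 0 |r|) :=
    DifferentiableOn.div (by fun_prop) (by fun_prop) hne
  have hmean : circleAverage (fun w : ℂ => (1 + w) / (1 - w)) 0 r = 1 := by
    rw [(hd.diffContOnCl_ball subset_rfl).circleAverage]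
    simp
  have hint : CircleIntegrable (fun w : ℂ => (1 + w) / (1 - w)) 0 r :=
    (hd.continuousOn.mono sphere_subset_closedBall).circleIntegrable'
  have hre := Complex.reCLM.circleAverage_comp_comm hint
  rw [hmean] at hre
  have hpt : Set.EqOn (Complex.reCLM ∘ fun w : ℂ => (1 + w) / (1 - w))
      ((1 - r ^ 2) • fun w : ℂ => (‖1 - w‖ ^ 2)⁻¹) (sphere 0 |r|) := by
    intro w hw
    have hw' : ‖w‖ = r := by rw [mem_sphere_zero_iff_norm.1 hw, abs_of_nonneg h0]
    have h1 : Complex.normSq w = r ^ 2 := by rw [Complex.normSq_eq_norm_sq, hw']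
    simp only [Function.comp_apply, Complex.reCLM_apply, Pi.smul_apply, smul_eq_mul,
      Complex.div_re, ← Complex.normSq_eq_norm_sq, ← h1]
    rw [Complex.normSq_apply w, ← add_div, div_eq_mul_inv]
    congr 1
    simp
    ring
  rw [circleAverage_congr_sphere hpt, circleAverage_smul] at hre
  simp only [smul_eq_mul, Complex.reCLM_apply, Complex.one_re] at hre
  rw [eq_inv_of_mul_eq_one_right hre]

theorem norm_coeff_mul_pow_le {b : ℕ → ℂ} {f : ℂ → ℂ} (hd : DifferentiableOn ℂ f (ball 0 1))
    (hf : ∀ z : ℂ, ‖z‖ < 1 → HasSum (fun n => b n * z ^ n) (f z)) {ε C : ℝ}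
    (hb : ∀ z : ℂ, ‖z‖ < 1 → ‖f z‖ ≤ ε * (‖1 - z‖ ^ 2)⁻¹ + C) {r : ℝ} (h0 : 0 < r) (hr : r < 1)
    (n : ℕ) : ‖b n‖ * r ^ n ≤ ε * (1 - r ^ 2)⁻¹ + C := by
  have habs : |r| < 1 := by rwa [abs_of_pos h0]
  have hsub : closedBall (0 : ℂ) r ⊆ ball 0 1 := closedBall_subset_ball hr
  lift r to NNReal using h0.le
  have h1 : HasFPowerSeriesAt f (cauchyPowerSeries f 0 r) 0 :=
    ((hd.mono hsub).hasFPowerSeriesOnBall (by exact_mod_cast h0)).hasFPowerSeriesAt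
  have h2 : HasFPowerSeriesAt f (FormalMultilinearSeries.ofScalars ℂ b) 0 := by
    rw [hasFPowerSeriesAt_iff]
    filter_upwards [ball_mem_nhds (0 : ℂ) one_pos] with z hz
    simpa [FormalMultilinearSeries.coeff_ofScalars, mul_comm] using hf z (by simpa using hz)
  have h3 : ‖b n‖ ≤ circleAverage (fun z => ‖f z‖) 0 r * |(r : ℝ)|⁻¹ ^ n := by
    have h := norm_cauchyPowerSeries_le f 0 r n
    rw [h1.eq_formalMultilinearSeries h2, FormalMultilinearSeries.norm_apply_eq_norm_coef,
      FormalMultilinearSeries.coeff_ofScalars] at h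
    simpa [circleAverage_def] using h
  have hsph : sphere (0 : ℂ) |(r : ℝ)| ⊆ ball 0 1 := by
    rw [abs_of_pos h0]
    exact sphere_subset_closedBall.trans hsub
  have hc := continuousOn_inv_norm_sq habs
  have hint1 : CircleIntegrable (fun w : ℂ => ε * (‖1 - w‖ ^ 2)⁻¹) 0 r :=
    (continuousOn_const.mul hc).circleIntegrable'
  have hint2 : CircleIntegrable (fun _ : ℂ => C) 0 r :=
    continuousOn_const.circleIntegrable'
  have h4 : circleAverage (fun z => ‖f z‖) 0 r ≤ ε * (1 - (r : ℝ) ^ 2)⁻¹ + C := by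
    refine (circleAverage_mono (f₂ := fun w => ε * (‖1 - w‖ ^ 2)⁻¹ + C)
      (hd.continuousOn.mono hsph).norm.circleIntegrable' (hint1.add hint2) fun z hz =>
      hb z (by simpa using hsph hz)).trans_eq ?_
    rw [circleAverage_fun_add hint1 hint2, circleAverage_const,
      ← circleAverage_inv_norm_sq h0.le hr]
    congr 1
    exact circleAverage_fun_smul (𝕜 := ℝ) (a := ε) (f := fun w : ℂ => (‖1 - w‖ ^ 2)⁻¹)
  rw [abs_of_pos h0] at h3
  calc ‖b n‖ * (r : ℝ) ^ n ≤ (circleAverage (fun z => ‖f z‖) 0 r * (r : ℝ)⁻¹ ^ n) * r ^ n := by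
        gcongr
    _ = circleAverage (fun z => ‖f z‖) 0 r := by
        rw [mul_assoc, ← mul_pow, inv_mul_cancel₀ h0.ne', one_pow, mul_one]
    _ ≤ _ := h4

/-- If a function on the unit disc is `o(‖1 - z‖⁻²)` up to a bounded function, its `n`-th Taylor
coefficient is `o(n)`: integrate over the circle of radius `1 - 1 / (n + 1)`. -/
theorem coeff_isLittleO {b : ℕ → ℂ} {f : ℂ → ℂ} (hd : DifferentiableOn ℂ f (ball 0 1))
    (hf : ∀ z : ℂ, ‖z‖ < 1 → HasSum (fun n => b n * z ^ n) (f z))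
    (hb : ∀ ε : ℝ, 0 < ε → ∃ C : ℝ, ∀ z : ℂ, ‖z‖ < 1 → ‖f z‖ ≤ ε * (‖1 - z‖ ^ 2)⁻¹ + C) :
    b =o[atTop] fun n : ℕ => (n : ℝ) := by
  rw [isLittleO_iff]
  intro c hc
  obtain ⟨C, hC⟩ := hb (c / 12) (by positivity)
  have hlarge : ∀ᶠ n : ℕ in atTop, 6 * C / c ≤ n :=
    tendsto_natCast_atTop_atTop.eventually_ge_atTop _
  filter_upwards [eventually_ge_atTop 1, hlarge] with n hn hn2
  have hn' : (1 : ℝ) ≤ n := by exact_mod_cast hn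
  set r : ℝ := n / (n + 1) with hr
  have hr0 : 0 < r := by positivity
  have hr1 : r < 1 := (div_lt_one (by positivity)).2 (by linarith)
  have h1 := norm_coeff_mul_pow_le hd hf hC hr0 hr1 n
  -- the loss `r ^ (-n) = (1 + 1 / n) ^ n` is less than `e`
  have h2 : 1 ≤ 3 * r ^ n := by
    have h3 : (1 + 1 / (n : ℝ)) ^ n ≤ exp 1 := by
      calc (1 + 1 / (n : ℝ)) ^ n ≤ (exp (1 / n)) ^ n := by
            gcongr
            linarith [add_one_le_exp (1 / (n : ℝ))]
        _ = exp 1 := by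
            rw [← exp_nat_mul]
            congr 1
            field_simp
    have h4 : (1 + 1 / (n : ℝ)) ^ n * r ^ n = 1 := by
      rw [← mul_pow, hr]
      convert one_pow n
      field_simp
    have h5 : exp 1 < 3 := exp_one_lt_three
    nlinarith [pow_pos hr0 n]
  have h6 : (1 - r ^ 2)⁻¹ ≤ (n : ℝ) + 1 := by
    rw [inv_le_comm₀ (by nlinarith) (by positivity)]
    have : ((n : ℝ) + 1)⁻¹ = 1 - r := by
      rw [hr]
      field_simp
      ring
    rw [this]
    nlinarith
  have h7 : 6 * C ≤ n * c := (div_le_iff₀ hc).1 hn2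
  rw [Real.norm_natCast]
  calc ‖b n‖ ≤ ‖b n‖ * (3 * r ^ n) := le_mul_of_one_le_right (norm_nonneg _) h2
    _ = 3 * (‖b n‖ * r ^ n) := by ring
    _ ≤ 3 * (c / 12 * (n + 1) + C) := by
        gcongr
        refine h1.trans ?_
        gcongr
    _ ≤ c * n := by nlinarith

end UnitDisc

/-! ### The generating function of `wiener * sigma` -/

namespace OrderedTree

open CubicBranch

/-- The analytic continuation of the generating function of `wiener * sigma`. -/
noncomputable def wienerFun (z : ℂ) : ℂ := wienerRat (branch z)

theorem differentiableOn_wienerFun : DifferentiableOn ℂ wienerFun domain := by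
  have h := differentiableOn_branch
  unfold wienerFun wienerRat
  refine DifferentiableOn.div (by fun_prop) (by fun_prop) fun z hz => ?_
  exact mul_ne_zero (pow_ne_zero 4 (branch_ne_third hz)) (pow_ne_zero 3 (branch_ne_one hz))

theorem hasSum_wienerFun {z : ℂ} (hz : ‖z‖ < 4 / 27) :
    HasSum (fun t : OrderedTree => (t.wiener : ℂ) * (t.sigma : ℂ) * z ^ t.size) (wienerFun z) := by
  have h := hasSum_gf (wiener_weight_le fun t => le_refl (sigma t)) hz
  rw [gf_wiener_sigma hz, gf_sigmaTwo_eq_branch hz] at h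
  simpa [wienerFun] using h

/-- The numerator in the representation of `wienerFun` with the denominator `wsDenominator`. The
variable `X 0` stands for `s`; the variable `X 1`, which stands for `z`, does not occur. -/
noncomputable def wienerNumerator : MvPolynomial (Fin 2) ℤ :=
  .X 0 ^ 2 * (3 * .X 0 ^ 2 - 17 * .X 0 ^ 3 + 39 * .X 0 ^ 4 - 45 * .X 0 ^ 5 + 25 * .X 0 ^ 6
    - 3 * .X 0 ^ 7 - 3 * .X 0 ^ 8 + .X 0 ^ 9)

/-- If `z = s (1 - s)²`, then `s² + s³ - z = -s (1 - 3 s)`. -/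
theorem wsDenominator_eq {s z : ℂ} (h : s * (1 - s) ^ 2 = z) :
    wsDenominator s z = s ^ 2 * ((1 - 3 * s) ^ 4 * (1 - s) ^ 3) := by
  rw [wsDenominator, ← h]
  ring

theorem wsDenominator_branch_ne_zero {z : ℂ} (hz : z ∈ domain) (h0 : z ≠ 0) :
    wsDenominator (branch z) z ≠ 0 := by
  rw [wsDenominator_eq (branch_cubic hz)]
  exact mul_ne_zero (pow_ne_zero 2 (branch_ne_zero hz h0))
    (mul_ne_zero (pow_ne_zero 4 (branch_ne_third hz)) (pow_ne_zero 3 (branch_ne_one hz)))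

theorem wienerFun_eq {z : ℂ} (hz : z ∈ domain) (h0 : z ≠ 0) :
    wienerFun z =
      MvPolynomial.aeval ![branch z, z] wienerNumerator / wsDenominator (branch z) z := by
  rw [wsDenominator_eq (branch_cubic hz), wienerFun, wienerRat]
  simp only [wienerNumerator, map_mul, map_add, map_sub, map_pow, map_ofNat, MvPolynomial.aeval_X,
    Matrix.cons_val_zero]
  rw [mul_div_mul_left _ _ (pow_ne_zero 2 (branch_ne_zero hz h0))]

/-- Since `1 - 27 z / 4 = (1 - 3 s)² (4 - 3 s) / 4`, the singularity at `4 / 27` is a double pole in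
`z`, up to a factor that is continuous in `s`. -/
theorem wienerFun_isEquivalent :
    wienerFun ~[𝓝[domain] (4 / 27 : ℂ)] fun z => 5 / (81 * (1 - 27 * z / 4) ^ 2) := by
  refine isEquivalent_of_tendsto_one ?_
  set g : ℂ → ℂ := fun s => (3 * s ^ 2 - 17 * s ^ 3 + 39 * s ^ 4 - 45 * s ^ 5 + 25 * s ^ 6
    - 3 * s ^ 7 - 3 * s ^ 8 + s ^ 9) * (81 * (4 - 3 * s) ^ 2) / (80 * (1 - s) ^ 3) with hg
  have hcont : ContinuousAt g (1 / 3) :=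
    ContinuousAt.div (by fun_prop) (by fun_prop) (by norm_num)
  have hval : g (1 / 3) = 1 := by norm_num [hg]
  have h := hcont.tendsto.comp tendsto_branch
  rw [hval] at h
  refine h.congr' ?_
  filter_upwards [self_mem_nhdsWithin] with z hz
  have h1 := branch_ne_one hz
  have h3 := branch_ne_third hz
  have h4 : 1 - 27 * z / 4 = (1 - 3 * branch z) ^ 2 * (4 - 3 * branch z) / 4 := by
    linear_combination (27 / 4) * branch_cubic hz
  have h5 : (4 - 3 * branch z) ≠ 0 := by
    intro h
    rw [h] at h4
    exact Complex.slitPlane_ne_zero hz (by simpa using h4)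
  simp only [Function.comp_apply, Pi.div_apply, hg, wienerFun, wienerRat]
  rw [h4]
  generalize branch z = s at *
  field_simp
  ring

/-- Away from the singularity `4 / 27` the continuation is bounded on the open disc. -/
theorem exists_norm_wienerFun_sub_le {ε : ℝ} (hε : 0 < ε) : ∃ C : ℝ, ∀ z : ℂ, ‖z‖ < 4 / 27 →
    ‖wienerFun z - 5 / (81 * (1 - 27 * z / 4) ^ 2)‖ ≤
      ε * ‖(5 / (81 * (1 - 27 * z / 4) ^ 2) : ℂ)‖ + C := by
  have h := wienerFun_isEquivalent.isLittleO.bound hε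
  obtain ⟨U, hU, hUo, h⟩ := mem_nhdsWithin.1 h
  have hK : IsCompact (Metric.closedBall (0 : ℂ) (4 / 27) \ U) :=
    (isCompact_closedBall _ _).diff hU
  have hKd : Metric.closedBall (0 : ℂ) (4 / 27) \ U ⊆ domain := by
    rintro z ⟨hz, hzU⟩
    refine mem_domain_iff.2 fun hz' => hzU ?_
    have h1 : ‖z‖ ≤ 4 / 27 := by simpa using hz
    have h2 : z.re = 4 / 27 := le_antisymm ((Complex.re_le_norm z).trans h1) hz'.2
    have h3 : z = 4 / 27 := by
      apply Complex.ext
      · rw [h2]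
        norm_num
      · rw [hz'.1]
        norm_num
    exact h3 ▸ hUo
  have hc : ContinuousOn (fun z => wienerFun z - 5 / (81 * (1 - 27 * z / 4) ^ 2)) domain := by
    refine differentiableOn_wienerFun.continuousOn.sub
      (ContinuousOn.div (by fun_prop) (by fun_prop) fun z hz => ?_)
    exact mul_ne_zero (by norm_num) (pow_ne_zero 2 (Complex.slitPlane_ne_zero hz))
  obtain ⟨C, hC⟩ := hK.exists_bound_of_continuousOn (hc.mono hKd)
  refine ⟨max C 0, fun z hz => ?_⟩
  by_cases hzU : z ∈ U
  · have h1 := h ⟨hzU, mem_domain_of_norm_lt hz⟩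
    simp only [Set.mem_ofPred_eq, Pi.sub_apply] at h1
    linarith [le_max_right C 0]
  · have h1 := hC z ⟨by simpa using hz.le, hzU⟩
    have h2 : 0 ≤ ε * ‖(5 / (81 * (1 - 27 * z / 4) ^ 2) : ℂ)‖ := by positivity
    linarith [le_max_left C 0]

/-- Ordering the trees by size turns the sum over all trees into a power series. -/
theorem hasSum_wienerFun_nat {z : ℂ} (hz : ‖z‖ < 4 / 27) :
    HasSum (fun n : ℕ => (∑ t ∈ treesOfSize n, (t.wiener : ℂ) * t.sigma) * z ^ n)
      (wienerFun z) := by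
  refine ((hasSum_wienerFun hz).tsum_fiberwise size).congr_fun fun n => ?_
  have hset : size ⁻¹' {n} = (treesOfSize n : Set OrderedTree) := by
    ext t
    simp [mem_treesOfSize]
  rw [hset, Finset.tsum_subtype' (treesOfSize n)
    (fun t : OrderedTree => (t.wiener : ℂ) * (t.sigma : ℂ) * z ^ t.size), Finset.sum_mul]
  exact Finset.sum_congr rfl fun t ht => by rw [mem_treesOfSize.1 ht]

theorem hasSum_succ_mul_geometric {z : ℂ} (hz : ‖z‖ < 1) :
    HasSum (fun n : ℕ => ((n : ℂ) + 1) * z ^ n) (1 / (1 - z) ^ 2) := by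
  simpa using hasSum_choose_mul_geometric_of_norm_lt_one 1 hz

/-- The function `(5 / 81) / (1 - 27 z / 4)²` has the coefficients
`(5 / 81) (n + 1) (27 / 4) ^ n`, and its difference to `wienerFun` contributes less. -/
theorem sum_wiener_mul_sigma_isEquivalent :
    (fun n : ℕ => ∑ t ∈ treesOfSize n, (t.wiener : ℝ) * t.sigma) ~[atTop]
      fun n : ℕ => 5 / 81 * (n : ℝ) * (27 / 4) ^ n := by
  set w : ℕ → ℝ := fun n => ∑ t ∈ treesOfSize n, (t.wiener : ℝ) * t.sigma with hw
  have hscale : ∀ z : ℂ, ‖z‖ < 1 → ‖4 / 27 * z‖ < 4 / 27 := by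
    intro z hz
    rw [norm_mul]
    norm_num
    linarith
  have hb : (fun n : ℕ => ((w n * (4 / 27) ^ n - 5 / 81 * (n + 1) : ℝ) : ℂ)) =o[atTop]
      fun n : ℕ => (n : ℝ) := by
    refine UnitDisc.coeff_isLittleO
      (f := fun z => wienerFun (4 / 27 * z) - 5 / (81 * (1 - 27 * (4 / 27 * z) / 4) ^ 2)) ?_ ?_ ?_
    · intro z hz
      have hz' := mem_domain_of_norm_lt (hscale z (by simpa using hz))
      have h1 : DifferentiableAt ℂ wienerFun (4 / 27 * z) :=
        differentiableOn_wienerFun.differentiableAt (isOpen_domain.mem_nhds hz')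
      refine DifferentiableAt.differentiableWithinAt ?_
      refine (h1.comp z (f := fun w : ℂ => 4 / 27 * w) (by fun_prop)).sub
        (DifferentiableAt.div (by fun_prop) (by fun_prop) ?_)
      exact mul_ne_zero (by norm_num) (pow_ne_zero 2 (Complex.slitPlane_ne_zero hz'))
    · intro z hz
      have h1 := hasSum_wienerFun_nat (hscale z hz)
      have h2 := (hasSum_succ_mul_geometric hz).mul_left (5 / 81)
      have h3 : 5 / (81 * (1 - 27 * (4 / 27 * z) / 4) ^ 2) = 5 / 81 * (1 / (1 - z) ^ 2) := by
        rw [show 1 - 27 * (4 / 27 * z) / 4 = 1 - z by ring, div_mul_div_comm, mul_one]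
      rw [h3]
      refine (h1.sub h2).congr_fun fun n => ?_
      simp only [hw]
      push_cast
      rw [mul_pow]
      ring
    · intro ε hε
      obtain ⟨C, hC⟩ := exists_norm_wienerFun_sub_le hε
      refine ⟨C, fun z hz => (hC _ (hscale z hz)).trans ?_⟩
      have h3 : ‖(5 / (81 * (1 - 27 * (4 / 27 * z) / 4) ^ 2) : ℂ)‖ =
          5 / 81 * (‖1 - z‖ ^ 2)⁻¹ := by
        rw [show 1 - 27 * (4 / 27 * z) / 4 = 1 - z by ring, norm_div, norm_mul, norm_pow,
          ← div_div, div_eq_mul_inv]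
        norm_num
      rw [h3]
      gcongr
      have h4 : 0 ≤ (‖1 - z‖ ^ 2)⁻¹ := by positivity
      linarith
  have hb' : (fun n : ℕ => w n * (4 / 27) ^ n - 5 / 81 * ((n : ℝ) + 1)) =o[atTop]
      fun n : ℕ => (n : ℝ) :=
    (hb.norm_left.congr_left fun n => Complex.norm_real _).of_norm_left
  have h1 : (fun _ : ℕ => (5 / 81 : ℝ)) =o[atTop] fun n : ℕ => (n : ℝ) :=
    isLittleO_const_left.2 (.inr (tendsto_norm_atTop_atTop.comp tendsto_natCast_atTop_atTop))
  have h2 : (fun n : ℕ => w n * (4 / 27) ^ n) ~[atTop] fun n : ℕ => 5 / 81 * (n : ℝ) := by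
    refine IsLittleO.isEquivalent (IsLittleO.const_mul_right (by norm_num) ?_)
    refine (hb'.add h1).congr_left fun n => ?_
    simp only [Pi.sub_apply]
    ring
  refine ((h2.mul (IsEquivalent.refl (u := fun n : ℕ => (27 / 4 : ℝ) ^ n))).congr_left ?_)
  refine Eventually.of_forall fun n => ?_
  simp only [Pi.mul_apply]
  rw [mul_assoc, ← mul_pow]
  norm_num

theorem expectation_wiener_mul_sigma_isEquivalent :
    (fun n : ℕ => OrderedTree.expectation (fun t => (t.wiener : ℝ) * (t.sigma : ℝ)) n)
      ~[atTop] fun n : ℕ =>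
        20 * Real.sqrt Real.pi / 81 * (n : ℝ) ^ (5 / 2 : ℝ) * (27 / 16 : ℝ) ^ n := by
  refine (sum_wiener_mul_sigma_isEquivalent.div card_treesOfSize_isEquivalent).congr_right ?_
  filter_upwards [eventually_gt_atTop 0] with n hn
  have hn' : (0 : ℝ) < n := by exact_mod_cast hn
  have h1 : (n : ℝ) ^ (5 / 2 : ℝ) = n * (n : ℝ) ^ (3 / 2 : ℝ) := by
    rw [show (5 / 2 : ℝ) = 1 + 3 / 2 by norm_num, Real.rpow_add hn', Real.rpow_one]
  have h2 : (27 / 16 : ℝ) ^ n = (27 / 4) ^ n / 4 ^ n := by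
    rw [← div_pow]
    norm_num
  simp only [Pi.div_apply]
  rw [h1, h2]
  field_simp
  norm_num

end OrderedTree

theorem mainTheorem4 :
    (∃ (N : MvPolynomial (Fin 2) ℤ) (R : ℝ) (S₂ WS : ℂ → ℂ),
      4 / 27 < R ∧
      (∀ z : ℂ, ‖z‖ < 4 / 27 →
        HasSum (fun t : OrderedTree => (t.sigmaTwo : ℂ) * z ^ t.size) (S₂ z)) ∧
      (∀ z : ℂ, ‖z‖ < 4 / 27 →
        HasSum (fun t : OrderedTree => (t.wiener : ℂ) * (t.sigma : ℂ) * z ^ t.size) (WS z)) ∧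
      AnalyticOnNhd ℂ S₂ (slitDisc R) ∧
      AnalyticOnNhd ℂ WS (slitDisc R) ∧
      (∀ z ∈ slitDisc R, z ≠ 0 →
        wsDenominator (S₂ z) z ≠ 0 ∧
        WS z = MvPolynomial.aeval ![S₂ z, z] N / wsDenominator (S₂ z) z) ∧
      WS ~[𝓝[slitDisc R] (4 / 27 : ℂ)] fun z => 5 / (81 * (1 - 27 * z / 4) ^ 2)) ∧
    (fun n : ℕ => OrderedTree.expectation (fun t => (t.wiener : ℝ) * (t.sigma : ℝ)) n)
      ~[atTop] fun n : ℕ =>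
        20 * Real.sqrt Real.pi / 81 * (n : ℝ) ^ (5 / 2 : ℝ) * (27 / 16 : ℝ) ^ n := by
  have hsub : slitDisc 1 ⊆ CubicBranch.domain := fun z hz => CubicBranch.mem_domain_iff.2 hz.2
  refine ⟨⟨OrderedTree.wienerNumerator, 1, CubicBranch.branch, OrderedTree.wienerFun, by norm_num,
    fun z hz => ?_, fun z hz => OrderedTree.hasSum_wienerFun hz, ?_, ?_, fun z hz h0 =>
    ⟨OrderedTree.wsDenominator_branch_ne_zero (hsub hz) h0,
      OrderedTree.wienerFun_eq (hsub hz) h0⟩, ?_⟩,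
    OrderedTree.expectation_wiener_mul_sigma_isEquivalent⟩
  · rw [← OrderedTree.gf_sigmaTwo_eq_branch hz]
    exact OrderedTree.hasSum_gf (OrderedTree.one_weight_le OrderedTree.sigmaTwo_le) hz
  · exact (CubicBranch.differentiableOn_branch.analyticOnNhd CubicBranch.isOpen_domain).mono hsub
  · exact (OrderedTree.differentiableOn_wienerFun.analyticOnNhd CubicBranch.isOpen_domain).mono hsub
  · exact OrderedTree.wienerFun_isEquivalent.mono (nhdsWithin_mono _ hsub)
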